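/- Let a finite group $G$ act by automorphisms over $\mathbb{C}$ on a smooth quasi-projective complex variety $X$ (not necessarily connected). Let $U\subseteq X$ be a $G$-stable Zariski dense open subset on which $G$ acts freely, let $\pi:X\to Y$ be the quotient of $X$ by $G$ (i.e. $\pi$ is affine and $G$-invariant, and $\mathcal{O}_Y=(\pi_*\mathcal{O}_X)^G$), and assume that $Y$ is smooth. Put $V=\pi(U)$ and $Z=Y\setminus V$. Sets of complex points are given the analytic topology. For $u\in U$ let $\psi_u:\pi_1(V,\pi(u))\to G$ be the map that sends the class of a loop $\gamma$ to the element $g\in G$ such that the lift of $\gamma$ to $U$ starting at $u$ ends at $g\cdot u$. For $z\in Z$, a good fundamental system of neighborhoods of $z$ relative to $Z$ is a collection $\mathscr{U}$ of open neighborhoods of $z$ in $Y$ such that every open neighborhood of $z$ contains a member of $\mathscr{U}$, and such that for all $W',W\in\mathscr{U}$ with $W'\subseteq W$ the inclusion $W'\setminus Z\hookrightarrow W\setminus Z$ is a homotopy equivalence; a good neighborhood of $z$ is a member of such a system. For a neighborhood $W$ of $z$, points $w\in W\setminus Z$ and $u\in U$, and a path $\delta$ in $V$ from $w$ to $\pi(u)$,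 let $H(W,w,u,\delta)\subseteq G$ be the image of the composition $$\pi_1(W\setminus Z,w)\longrightarrow \pi_1(V,\pi(u))\xrightarrow{\ \psi_u\ } G,$$ whose first map is induced by the inclusion and by change of base point along $\delta$. For $W$ a good neighborhood of $z$, this is the local monodromy subgroup $H(z)$; it is considered up to conjugation in $G$. Let $x\in X\setminus U$ be a closed point, with stabilizer $G_x$. Then $H(\pi(x))=G_x$. More precisely: for every good neighborhood $W$ of $\pi(x)$ relative to $Z$, every subgroup $H(W,w,u,\delta)$ is conjugate to $G_x$ in $G$, and $H(W,w,u,\delta)=G_x$ for some choice of $w,u,\delta$. The same holds for all sufficiently small connected open neighborhoods: there is an open neighborhood $N$ of $\pi(x)$ such that the preceding sentence is true for every connected open neighborhood $W\subseteq N$ of $\pi(x)$. -/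

import Mathlib

open CategoryTheory AlgebraicGeometry

noncomputable section

namespace GaloisMonodromy

/-! ### Topology: good neighborhoods and local monodromy -/

section Topological

variable {T : Type*} [TopologicalSpace T]

/-- The inclusion of subspaces `A ⊆ B`, as a continuous map. -/
def inclusionMap {A B : Set T} (h : A ⊆ B) : C(A, B) :=
  ⟨Set.inclusion h, continuous_inclusion h⟩

/-- A good fundamental system of neighborhoods of `t` relative to `Z`: a collection of open
neighborhoods of `t`, arbitrarily small, such that for all members `V ⊆ U` the inclusion
`V \ Z → U \ Z` is a homotopy equivalence. -/
structure IsGoodSystem (Z : Set T) (t : T) (𝒰 : Set (Set T)) : Prop where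
  isOpen : ∀ U ∈ 𝒰, IsOpen U
  mem : ∀ U ∈ 𝒰, t ∈ U
  cofinal : ∀ N : Set T, IsOpen N → t ∈ N → ∃ U ∈ 𝒰, U ⊆ N
  homotopyEquiv : ∀ U ∈ 𝒰, ∀ V ∈ 𝒰, ∀ h : V ⊆ U,
    ∃ e : ContinuousMap.HomotopyEquiv ↥(V \ Z) ↥(U \ Z),
      e.toFun = inclusionMap (Set.sdiff_subset_sdiff_left h)

/-- A good neighborhood of `t` relative to `Z`: a member of a good fundamental system. -/
def IsGoodNeighborhood (Z : Set T) (t : T) (W : Set T) : Prop :=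
  ∃ 𝒰 : Set (Set T), IsGoodSystem Z t 𝒰 ∧ W ∈ 𝒰

/-- The homomorphism `π₁(W ∩ V, w) → π₁(V, v)` given by the inclusion `W ∩ V ⊆ V` followed by
the change of base point along a path `δ` in `V` from `w` to `v`. If `Z` is the complement of
`V`, then `W ∩ V = W \ Z`. -/
def localToGlobal (W V : Set T) (w : ↥(W ∩ V)) (v : V)
    (δ : Path (inclusionMap Set.inter_subset_right w : V) v) :
    FundamentalGroup ↥(W ∩ V) w →* FundamentalGroup V v :=
  (FundamentalGroup.fundamentalGroupMulEquivOfPath δ).toMonoidHom.comp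
    (FundamentalGroup.map (inclusionMap Set.inter_subset_right) w)

variable {E : Type*} [TopologicalSpace E] {G : Type*} [Group G] [MulAction G E]

/-- The image of a point of `U` in `p(U)`. -/
def imagePoint (p : E → T) (U : Set E) (u : U) : ↥(p '' U) :=
  ⟨p u, u, u.2, rfl⟩

/-- The graph of `ψ_u : π₁(V, p(u)) → G`, where `V = p(U)`: the element `c` is related to `g` if
`c` is the class of a loop `γ` which has a lift to a path in `U` from `u` to `g • u`. (When `G`
acts freely on `U` and `U → V` is the quotient covering, each `c` has exactly one such `g`.) -/
def IsMonodromyOf (p : E → T) (U : Set E) (u : U)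
    (c : FundamentalGroup ↥(p '' U) (imagePoint p U u)) (g : G) : Prop :=
  ∃ γ : Path (imagePoint p U u) (imagePoint p U u),
    c = FundamentalGroup.fromPath (Path.Homotopic.Quotient.mk γ) ∧
    ∃ Γ : C(unitInterval, U), (∀ t, p (Γ t) = γ t) ∧ Γ 0 = u ∧ (Γ 1 : E) = g • (u : E)

/-- The image in `G` of the composition `π₁(W ∩ V, w) → π₁(V, p(u)) → G` of the homomorphism
attached to the path `δ` with `ψ_u`, where `V = p(U)`. -/
def localMonodromy (G : Type*) [Group G] [MulAction G E] (p : E → T) (U : Set E) (W : Set T)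
    (w : ↥(W ∩ p '' U)) (u : U)
    (δ : Path (inclusionMap Set.inter_subset_right w : ↥(p '' U)) (imagePoint p U u)) : Set G :=
  {g | ∃ c ∈ (localToGlobal W (p '' U) w (imagePoint p U u) δ).range, IsMonodromyOf p U u c g}

/-- The local monodromy computed in the neighborhood `W` is the subgroup `K`, up to conjugation:
whatever the base point `w`, the point `u` and the path `δ`, the image is a conjugate of `K`, and
for suitable choices it is `K` itself. -/
def LocalMonodromyEq (p : E → T) (U : Set E) (W : Set T) (K : Subgroup G) : Prop :=
  (∀ w u δ, ∃ k : G,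
    localMonodromy G p U W w u δ = (K.map (MulAut.conj k).toMonoidHom : Set G)) ∧
  ∃ w u δ, localMonodromy G p U W w u δ = (K : Set G)

end Topological

/-! ### Complex points with the analytic topology -/

/-- `Spec ℂ`. -/
abbrev SpecC : Scheme.{0} := Spec (CommRingCat.of ℂ)

/-- The `ℂ`-points of a scheme over `ℂ`, i.e. (for schemes locally of finite type) its closed
points. -/
def ComplexPoint (X : Over SpecC) : Type := Over.mk (𝟙 SpecC) ⟶ X

namespace ComplexPoint

variable {X Y : Over SpecC}

/-- The underlying morphism of schemes `Spec ℂ ⟶ X`. -/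
def morphism (x : ComplexPoint X) : SpecC ⟶ X.left :=
  Over.Hom.left (f := Over.mk (𝟙 SpecC)) x

/-- The underlying point of the scheme. -/
def pt (x : ComplexPoint X) : X.left :=
  x.morphism (IsLocalRing.closedPoint ℂ)

theorem top_le (x : ComplexPoint X) {U : X.left.Opens} (h : x.pt ∈ U) :
    ⊤ ≤ x.morphism ⁻¹ᵁ U := by
  intro s _
  have hs : s = IsLocalRing.closedPoint ℂ :=
    Subsingleton.elim (α := PrimeSpectrum ℂ) s (IsLocalRing.closedPoint ℂ)
  subst hs
  exact h

/-- The value `f(x)` of a regular function `f` on `U` at a `ℂ`-point `x` of `U`. -/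
def eval (x : ComplexPoint X) {U : X.left.Opens} (h : x.pt ∈ U) (f : Γ(X.left, U)) : ℂ :=
  (Scheme.ΓSpecIso (CommRingCat.of ℂ)).hom
    (x.morphism.appLE U ⊤ (x.top_le h) f)

/-- The analytic topology: the coarsest topology for which the `ℂ`-points of each Zariski open
`U` form an open set on which all regular functions on `U` are continuous. -/
instance : TopologicalSpace (ComplexPoint X) :=
  TopologicalSpace.generateFrom
    {S | ∃ (U : X.left.Opens) (f : Γ(X.left, U)) (O : Set ℂ), IsOpen O ∧
      S = {x | ∃ h : x.pt ∈ U, x.eval h f ∈ O}}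

/-- The map on `ℂ`-points induced by a morphism. -/
def map (φ : X ⟶ Y) (x : ComplexPoint X) : ComplexPoint Y :=
  CategoryStruct.comp (obj := Over SpecC) x φ

/-- The `ℂ`-points of an open subscheme. -/
def pointsIn (U : X.left.Opens) : Set (ComplexPoint X) :=
  {x | x.pt ∈ U}

end ComplexPoint

/-! ### Quasi-projective schemes, group actions and quotients -/

/-- Projective `n`-space over `ℂ`. -/
def projectiveSpace (n : ℕ) : Over SpecC :=
  letI : GradedAlgebra (MvPolynomial.homogeneousSubmodule (Fin (n + 1)) ℂ) :=
    MvPolynomial.gradedAlgebra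
  Over.mk (Proj.toSpecZero (MvPolynomial.homogeneousSubmodule (Fin (n + 1)) ℂ) ≫
    Spec.map (CommRingCat.ofHom
      (algebraMap ℂ (MvPolynomial.homogeneousSubmodule (Fin (n + 1)) ℂ 0))))

/-- A quasi-projective scheme over `ℂ`: a locally closed subscheme of a projective space. -/
def IsQuasiProjective (X : Over SpecC) : Prop :=
  ∃ (n : ℕ) (i : X ⟶ projectiveSpace n), IsImmersion i.left

section Action

variable {G : Type*} [Group G] {X Y : Over SpecC}

/-- The left action on `ℂ`-points of a group acting on `X` by automorphisms over `ℂ`. -/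
abbrev pointAction (ρ : G →* Aut X) : MulAction G (ComplexPoint X) where
  smul g x := x.map (ρ g).hom
  one_smul x := by
    change x.map (ρ 1).hom = x
    rw [map_one]
    exact Category.comp_id (obj := Over SpecC) _
  mul_smul g h x := by
    change x.map (ρ (g * h)).hom = (x.map (ρ h).hom).map (ρ g).hom
    rw [map_mul]
    exact (Category.assoc (obj := Over SpecC) _ _ _).symm

/-- The stabilizer of a `ℂ`-point. -/
def pointStabilizer (ρ : G →* Aut X) (x : ComplexPoint X) : Subgroup G :=
  letI := pointAction ρ
  MulAction.stabilizer G x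

/-- `G` acts freely on the open subset `U`: `U` is `G`-stable and no `g ≠ 1` fixes a closed
point of `U`. -/
structure ActsFreelyOn (ρ : G →* Aut X) (U : X.left.Opens) : Prop where
  stable : ∀ g, (ρ g).hom.left ⁻¹ᵁ U = U
  free : ∀ x ∈ ComplexPoint.pointsIn U, pointStabilizer ρ x = ⊥

theorem le_preimage {ρ : G →* Aut X} {π : X ⟶ Y} {g : G} (h : (ρ g).hom ≫ π = π)
    (V : Y.left.Opens) : π.left ⁻¹ᵁ V ≤ (ρ g).hom.left ⁻¹ᵁ (π.left ⁻¹ᵁ V) := by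
  rw [← Scheme.Hom.comp_preimage, ← Over.comp_left, h]

/-- `π : X ⟶ Y` is the quotient of `X` by the finite group `G`: it is affine and `G`-invariant,
and `𝒪_Y → π_* 𝒪_X` identifies `𝒪_Y` with the `G`-invariant sections. -/
structure IsQuotient (ρ : G →* Aut X) (π : X ⟶ Y) : Prop where
  invariant : ∀ g, (ρ g).hom ≫ π = π
  affine : IsAffineHom π.left
  injective : ∀ V : Y.left.Opens, Function.Injective (π.left.app V)
  range : ∀ (V : Y.left.Opens) (s : Γ(X.left, π.left ⁻¹ᵁ V)),
    s ∈ Set.range (π.left.app V) ↔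
      ∀ g, (ρ g).hom.left.appLE (π.left ⁻¹ᵁ V) (π.left ⁻¹ᵁ V) (le_preimage (invariant g) V) s = s

end Action

end GaloisMonodromy

end

open Topology

/-! Write `p` for the map on complex points. Lifting `δ⁻¹` from `u` gives a point `u'` over `w`, and
a loop in `W \ Z` lifts to a path in `U ∩ p⁻¹(W)` from `u'` to some `g • u'`. So the local monodromy
is the set of `g` that keep `u'` in its path component of `U ∩ p⁻¹(W)` (`exists_localMonodromy_eq`),
and the theorem becomes a statement about these components.

Choose a slice `O` at `x`: an open neighborhood stable under `G_x` and disjoint from its other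
translates. For `B ⊆ p(O)` connected, open and containing `p(x)`, the preimage of `B` is the union
of the translates of `O ∩ p⁻¹(B)`. This piece is connected: the `G_x`-saturation of a component and
its complement have disjoint open images covering `B`, so every component reaches `x`. Intersecting
with `U` leaves it path connected, by the local structure described below. Hence the components over
`B` are permuted transitively, one of them with stabilizer `G_x`; this settles small connected
neighborhoods. A good neighborhood `W` is compared with such a `B` by squeezing `W' ⊆ B ⊆ W` with
`W'` in the same good system: the homotopy equivalence moves loops and points of `W \ Z` into `W' \
Z`, so `W` and `B` give the same answer.

Two facts about varieties feed this argument. First, `p` is open with orbits as fibers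
(`IsInvariantRing.isOpenMap`, `IsInvariantRing.exists_comp_eq`): functions on `X` are integral over
functions on `Y`, so they stay bounded along ultrafilters converging below, and limits of points
exist upstairs. Second, every point of `X` has small neighborhoods meeting `U` in a nonempty path
connected set (`exists_isPathConnected_inter`). Path connectedness comes from holomorphic charts: on
a complex line the zeros of a nonzero holomorphic function are countable and can be avoided.
Nonemptiness is the passage from Zariski to analytic density: a function vanishing analytically near
`x` lies in all powers of the maximal ideal, so Krull's theorem annihilates it by a function nonzero
at `x`. -/

namespace GaloisMonodromy

/-! ### Slices and the covering over the free locus -/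

section FiniteQuotient

variable {E T G : Type*} [TopologicalSpace E] [TopologicalSpace T] [Group G] [MulAction G E]

/-- A topological quotient by a group action all of whose orbits consist of points that can be
separated from each other. -/
structure IsSeparatedQuotient (G : Type*) [Group G] [MulAction G E] (p : E → T) : Prop where
  continuous_smul : ∀ g : G, Continuous fun a : E => g • a
  continuous : Continuous p
  isOpenMap : IsOpenMap p
  eq_iff : ∀ a b : E, p a = p b ↔ ∃ g : G, g • a = b
  separated : ∀ (g : G) (a : E), g • a ≠ a →
    ∃ O O' : Set E, IsOpen O ∧ IsOpen O' ∧ a ∈ O ∧ g • a ∈ O' ∧ Disjoint O O'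

/-- An open subset stable under the action, on which the action is free. -/
structure IsFreeOpen (G : Type*) [Group G] [MulAction G E] (U : Set E) : Prop where
  isOpen : IsOpen U
  smul_mem : ∀ (g : G), ∀ a ∈ U, g • a ∈ U
  free : ∀ (g : G), ∀ a ∈ U, g • a = a → g = 1

/-- The elements of `G` that move `u` to a point of the same path component of `A`. -/
def pathTransporter (G : Type*) [Group G] [MulAction G E] (A : Set E) (u : E) : Set G :=
  {g | JoinedIn A u (g • u)}

theorem IsSeparatedQuotient.apply_smul {p : E → T} (hp : IsSeparatedQuotient G p) (g : G) (a : E) :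
    p (g • a) = p a := ((hp.eq_iff _ _).2 ⟨g, rfl⟩).symm

/-- Around every point there is an open set, stable under the stabilizer, and disjoint from its
other translates. -/
theorem IsSeparatedQuotient.exists_slice [Finite G] {p : E → T} (hp : IsSeparatedQuotient G p)
    (x : E) : ∃ O : Set E, IsOpen O ∧ x ∈ O ∧ (∀ g : G, g • x = x → ∀ a ∈ O, g • a ∈ O) ∧
      ∀ g : G, g • x ≠ x → ∀ a ∈ O, g • a ∉ O := by
  have hs : ∀ g : G, ∃ O : Set E, IsOpen O ∧ x ∈ O ∧ (g • x ≠ x → ∀ a ∈ O, g • a ∉ O) := by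
    intro g
    by_cases hg : g • x = x
    · exact ⟨Set.univ, isOpen_univ, trivial, fun h => (h hg).elim⟩
    · obtain ⟨O, O', hO, hO', hx, hx', hd⟩ := hp.separated g x hg
      refine ⟨O ∩ (fun a => g • a) ⁻¹' O', hO.inter (hO'.preimage (hp.continuous_smul g)),
        ⟨hx, hx'⟩, fun _ a ha ha' => Set.disjoint_left.1 hd ha'.1 ha.2⟩
  choose O hO hxO hdis using hs
  let P : Set E := ⋂ g, O g
  have hP : IsOpen P := isOpen_iInter_of_finite hO
  have hxP : x ∈ P := Set.mem_iInter.2 hxO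
  have hPd : ∀ g : G, g • x ≠ x → ∀ a ∈ P, g • a ∉ P := fun g hg a ha ha' =>
    hdis g hg a (Set.mem_iInter.1 ha g) (Set.mem_iInter.1 ha' g)
  -- Intersecting the translates of `P` over the stabilizer makes the set stable; the factor `h = 1`
  -- keeps it inside `P`, which preserves disjointness.
  refine ⟨⋂ h : MulAction.stabilizer G x, (fun a => (h : G) • a) ⁻¹' P,
    isOpen_iInter_of_finite fun h => hP.preimage (hp.continuous_smul h),
    Set.mem_iInter.2 fun h => ?_, fun g hg a ha => Set.mem_iInter.2 fun h => ?_,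
    fun g hg a ha ha' => ?_⟩
  · change (h : G) • x ∈ P
    rw [show (h : G) • x = x from h.2]; exact hxP
  · change (h : G) • g • a ∈ P
    rw [← mul_smul]
    exact Set.mem_iInter.1 ha (h * ⟨g, hg⟩)
  · have h1 := Set.mem_iInter.1 ha 1
    have h2 := Set.mem_iInter.1 ha' 1
    simp only [OneMemClass.coe_one, Set.mem_preimage, one_smul] at h1 h2
    exact hPd g hg a h1 h2

/-- At a point of `U` the stabilizer is trivial, so a slice is disjoint from all its nontrivial
translates, as a quotient covering requires. -/
theorem IsSeparatedQuotient.isCoveringMap [Finite G] {p : E → T} (hp : IsSeparatedQuotient G p)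
    {U : Set E} (hU : IsFreeOpen G U) : IsCoveringMap (imagePoint p U) := by
  let : MulAction G U :=
    { smul := fun g a => ⟨g • (a : E), hU.smul_mem g a a.2⟩
      one_smul := fun a => Subtype.ext (one_smul G (a : E))
      mul_smul := fun g h a => Subtype.ext (mul_smul g h (a : E)) }
  have hcont : Continuous (imagePoint p U) :=
    (hp.continuous.comp continuous_subtype_val).subtype_mk _
  have hopen : IsOpenMap (imagePoint p U) := by
    intro O hO
    have h1 : IsOpen (p '' (Subtype.val '' O)) := hp.isOpenMap _ (hU.isOpen.isOpenMap_subtype_val _ hO)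
    convert h1.preimage (continuous_subtype_val : Continuous ((↑) : ↥(p '' U) → T)) using 1
    ext ⟨t, ht⟩
    constructor
    · rintro ⟨a, ha, h⟩
      exact ⟨a, ⟨a, ha, rfl⟩, congrArg Subtype.val h⟩
    · rintro ⟨_, ⟨a, ha, rfl⟩, h⟩
      exact ⟨a, ha, Subtype.ext h⟩
  have hsurj : Function.Surjective (imagePoint p U) := by
    rintro ⟨t, a, ha, rfl⟩
    exact ⟨⟨a, ha⟩, rfl⟩
  have : IsQuotientCoveringMap (imagePoint p U) G :=
    { toIsQuotientMap := hopen.isQuotientMap hcont hsurj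
      continuous_const_smul := fun g =>
        ((hp.continuous_smul g).comp continuous_subtype_val).subtype_mk _
      apply_eq_iff_mem_orbit := by
        intro a b
        rw [Subtype.ext_iff]
        change p a = p b ↔ _
        rw [eq_comm, hp.eq_iff]
        exact exists_congr fun g => by rw [Subtype.ext_iff]; rfl
      disjoint := by
        intro a
        obtain ⟨O, hO, haO, -, hd⟩ := hp.exists_slice (G := G) (a : E)
        refine ⟨Subtype.val ⁻¹' O, (hO.preimage continuous_subtype_val).mem_nhds haO, ?_⟩
        rintro g ⟨_, ⟨b, hb, rfl⟩, hb'⟩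
        by_contra hg
        exact hd g (fun h => hg (hU.free g a a.2 h)) b hb hb' }
  exact this.isCoveringMap

theorem localToGlobal_mk {W V : Set T} (w : ↥(W ∩ V)) (v : V)
    (δ : Path (inclusionMap Set.inter_subset_right w : V) v) (γ : Path w w) :
    localToGlobal W V w v δ (FundamentalGroup.fromPath (Path.Homotopic.Quotient.mk γ)) =
      FundamentalGroup.fromPath (Path.Homotopic.Quotient.mk
        (δ.symm.trans ((γ.map (inclusionMap Set.inter_subset_right).continuous).trans δ))) := by
  rfl

end FiniteQuotient

/-! ### Path lifting and local monodromy -/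

section FiniteQuotient

variable {E T G : Type*} [TopologicalSpace E] [TopologicalSpace T] [Group G] [MulAction G E]

theorem _root_.IsCoveringMap.endpoint_eq {A B : Type*} [TopologicalSpace A] [TopologicalSpace B]
    {q : A → B} (cov : IsCoveringMap q) {e e₁ e₂ : A} (Γ₁ : Path e e₁) (Γ₂ : Path e e₂) {a b : B}
    (γ₁ γ₂ : Path a b) (h₁ : ∀ t, q (Γ₁ t) = γ₁ t) (h₂ : ∀ t, q (Γ₂ t) = γ₂ t)
    (h : γ₁.Homotopic γ₂) : e₁ = e₂ := by
  have hs₁ : γ₁ 0 = q e := by rw [← h₁, Γ₁.source]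
  have hs₂ : γ₂ 0 = q e := by rw [← h₂, Γ₂.source]
  have e1 : Γ₁.toContinuousMap = cov.liftPath γ₁.toContinuousMap e hs₁ :=
    (cov.eq_liftPath_iff' _).2 ⟨funext h₁, Γ₁.source⟩
  have e2 : Γ₂.toContinuousMap = cov.liftPath γ₂.toContinuousMap e hs₂ :=
    (cov.eq_liftPath_iff' _).2 ⟨funext h₂, Γ₂.source⟩
  have := cov.liftPath_apply_one_eq_of_homotopicRel h e hs₁ hs₂
  rw [← e1, ← e2] at this
  exact Γ₁.target.symm.trans (this.trans Γ₂.target)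

theorem _root_.IsCoveringMap.exists_path_lift {A B : Type*} [TopologicalSpace A]
    [TopologicalSpace B] {q : A → B} (cov : IsCoveringMap q) {a b : B} (γ : Path a b) {e : A}
    (he : q e = a) : ∃ (e' : A) (Γ : Path e e'), ∀ t, q (Γ t) = γ t := by
  have hs : γ.toContinuousMap 0 = q e := by rw [he]; exact γ.source
  exact ⟨_, ⟨cov.liftPath γ.toContinuousMap e hs, cov.liftPath_zero .., rfl⟩,
    fun t => congrFun (cov.liftPath_lifts γ.toContinuousMap e hs) t⟩

theorem _root_.Path.trans_lift {A B : Type*} [TopologicalSpace A] [TopologicalSpace B] {q : A → B}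
    {e₀ e₁ e₂ : A} {Γ : Path e₀ e₁} {Γ' : Path e₁ e₂} {a b c : B} {γ : Path a b} {γ' : Path b c}
    (h : ∀ t, q (Γ t) = γ t) (h' : ∀ t, q (Γ' t) = γ' t) (t : unitInterval) :
    q (Γ.trans Γ' t) = γ.trans γ' t := by
  rw [Path.trans_apply, Path.trans_apply]
  split_ifs
  exacts [h _, h' _]

/-- The translate of a path in a stable set. -/
def translatePath {p : E → T} (hp : IsSeparatedQuotient G p) {U : Set E} (hU : IsFreeOpen G U)
    (g : G) {a b : U} (Γ : Path a b) :
    Path (⟨g • (a : E), hU.smul_mem g a a.2⟩ : U) ⟨g • (b : E), hU.smul_mem g b b.2⟩ :=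
  Γ.map (f := fun c : U => (⟨g • (c : E), hU.smul_mem g c c.2⟩ : U))
    (((hp.continuous_smul g).comp continuous_subtype_val).subtype_mk _)

theorem imagePoint_translatePath {p : E → T} (hp : IsSeparatedQuotient G p) {U : Set E}
    (hU : IsFreeOpen G U) (g : G) {a b : U} (Γ : Path a b) (t : unitInterval) :
    imagePoint p U (translatePath hp hU g Γ t) = imagePoint p U (Γ t) :=
  Subtype.ext (hp.apply_smul g _)

/-- The local monodromy is the stabilizer of a path component of the preimage. -/
theorem exists_localMonodromy_eq [Finite G] {p : E → T} (hp : IsSeparatedQuotient G p) {U : Set E}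
    (hU : IsFreeOpen G U) (W : Set T) (w : ↥(W ∩ p '' U)) (u : U)
    (δ : Path (inclusionMap Set.inter_subset_right w : ↥(p '' U)) (imagePoint p U u)) :
    ∃ u' : U, p u' = w ∧
      (∀ (v : U) (Γ : Path u v), (∀ t, imagePoint p U (Γ t) = δ.symm t) → v = u') ∧
      localMonodromy G p U W w u δ = pathTransporter G (U ∩ p ⁻¹' W) u' := by
  have cov := hp.isCoveringMap hU
  -- The point `u'` is the end of the lift of `δ⁻¹` starting at `u`.
  obtain ⟨u', Δ, hΔ⟩ := cov.exists_path_lift δ.symm (e := u) rfl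
  have hΔs : ∀ t, imagePoint p U (Δ.symm t) = δ t := fun t =>
    (hΔ _).trans (congrArg δ (unitInterval.symm_symm t))
  have hpu' : p u' = w := by
    have := congrArg Subtype.val (hΔ 1)
    rw [Δ.target, δ.symm.target] at this
    exact this
  refine ⟨u', hpu', fun v Γ hΓ => cov.endpoint_eq Γ Δ _ _ hΓ hΔ (.refl _), Set.ext fun g => ⟨?_, ?_⟩⟩
  · rintro ⟨_, ⟨c, rfl⟩, γ, hc, Γ, hΓ, hΓ0, hΓ1⟩
    induction c using Path.Homotopic.Quotient.ind with | mk γ₀ =>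
    have hhom : (δ.symm.trans ((γ₀.map
        (inclusionMap Set.inter_subset_right).continuous).trans δ)).Homotopic γ :=
      Path.Homotopic.Quotient.exact hc
    obtain ⟨u₁, Γ₀, hΓ₀⟩ := cov.exists_path_lift (e := u')
      (γ₀.map (inclusionMap Set.inter_subset_right).continuous) (Subtype.ext hpu')
    have hu₁ : p u' = p u₁ := by
      have := congrArg Subtype.val (hΓ₀ 1)
      rw [Γ₀.target] at this
      rw [hpu']
      exact (this.trans (congrArg Subtype.val (Path.target _))).symm
    obtain ⟨k, hk⟩ := (hp.eq_iff _ _).1 hu₁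
    have hu₁' : (⟨k • (u' : E), hU.smul_mem k u' u'.2⟩ : U) = u₁ := Subtype.ext hk
    subst hu₁'
    -- The lift of `δ⁻¹ · γ₀ · δ` from `u` is `Δ`, then `Γ₀`, then the `k`-translate of `Δ`
    -- reversed. It ends at `k • u`; comparison with `Γ` and freeness give `g = k`.
    have hend := cov.endpoint_eq (Δ.trans (Γ₀.trans (translatePath hp hU k Δ.symm)))
      (⟨Γ, hΓ0, rfl⟩ : Path u (Γ 1)) _ _
      (Path.trans_lift hΔ (Path.trans_lift hΓ₀ (γ' := δ) fun t => ?_))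
      (fun t => Subtype.ext (hΓ t)) hhom
    · have hgk : k • (u : E) = g • (u : E) := (congrArg Subtype.val hend).trans hΓ1
      have : g = k := by
        have := hU.free (k⁻¹ * g) u u.2 (by rw [mul_smul, ← hgk, inv_smul_smul])
        rw [inv_mul_eq_one] at this
        exact this.symm
      subst this
      refine ⟨Γ₀.map continuous_subtype_val, fun t => ⟨(Γ₀ t).2, ?_⟩⟩
      have := congrArg Subtype.val (hΓ₀ t)
      change p (Γ₀ t) ∈ W
      rw [show p (Γ₀ t) = _ from this]
      exact (γ₀ t).2.1
    · rw [imagePoint_translatePath, hΔs]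
  · rintro ⟨Γ₀, hΓ₀⟩
    let γ₀ : Path w w :=
      { toFun := fun t => ⟨p (Γ₀ t), (hΓ₀ t).2, Γ₀ t, (hΓ₀ t).1, rfl⟩
        continuous_toFun := (hp.continuous.comp Γ₀.continuous).subtype_mk _
        source' := Subtype.ext (by simp [hpu'])
        target' := Subtype.ext (by simp [hp.apply_smul, hpu']) }
    let Γ₁ : Path u' (⟨g • (u' : E), hU.smul_mem g u' u'.2⟩ : U) :=
      { toFun := fun t => ⟨Γ₀ t, (hΓ₀ t).1⟩
        continuous_toFun := Γ₀.continuous.subtype_mk _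
        source' := Subtype.ext (by simp)
        target' := Subtype.ext (by simp) }
    refine ⟨_, ⟨FundamentalGroup.fromPath (Path.Homotopic.Quotient.mk γ₀), rfl⟩, _,
      localToGlobal_mk w _ δ γ₀, (Δ.trans (Γ₁.trans (translatePath hp hU g Δ.symm))).toContinuousMap,
      fun t => congrArg Subtype.val (Path.trans_lift hΔ (Path.trans_lift (γ' := δ) 
        (γ := γ₀.map (inclusionMap Set.inter_subset_right).continuous) (fun t => rfl) fun t => ?_) t), 
      ?_, ?_⟩
    · rw [imagePoint_translatePath, hΔs]
    · exact Path.source _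
    · exact congrArg Subtype.val (Path.target _)

end FiniteQuotient

/-! ### Homotopy equivalences on components and loops -/

theorem exists_joined_of_homotopyEquiv {A B : Type*} [TopologicalSpace A] [TopologicalSpace B]
    (e : ContinuousMap.HomotopyEquiv A B) (b : B) : ∃ a, Joined b (e.toFun a) := by
  obtain ⟨H⟩ := e.right_inv
  exact ⟨e.invFun b, ⟨(H.evalAt b).symm⟩⟩

/-- Fullness of the induced equivalence of fundamental groupoids. -/
theorem exists_loop_of_homotopyEquiv {A B : Type*} [TopologicalSpace A] [TopologicalSpace B]
    (e : ContinuousMap.HomotopyEquiv A B) (a : A) (γ : Path (e.toFun a) (e.toFun a)) :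
    ∃ γ₀ : Path a a, (γ₀.map e.toFun.continuous).Homotopic γ := by
  obtain ⟨f, hf⟩ := (FundamentalGroupoidFunctor.equivOfHomotopyEquiv e).fullyFaithfulFunctor.map_surjective (X := FundamentalGroupoid.mk a) (Y := FundamentalGroupoid.mk a)
    (Path.Homotopic.Quotient.mk γ)
  induction f using Path.Homotopic.Quotient.ind with | mk γ₀ =>
  exact ⟨γ₀, Path.Homotopic.Quotient.exact hf⟩

/-! ### Path connectedness after removing the complement of `U` -/

section Trace

variable {E : Type*} [TopologicalSpace E]

/-- Every point has arbitrarily small open neighborhoods whose intersection with `U` is path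
connected and nonempty. -/
def HasLocallyConnectedTrace (U : Set E) : Prop :=
  ∀ (a : E) (O : Set E), IsOpen O → a ∈ O →
    ∃ N : Set E, IsOpen N ∧ a ∈ N ∧ N ⊆ O ∧ IsPathConnected (N ∩ U)

variable {U : Set E} (hU : HasLocallyConnectedTrace U)
include hU

theorem HasLocallyConnectedTrace.inter_nonempty {O : Set E} (hO : IsOpen O) (hne : O.Nonempty) :
    (O ∩ U).Nonempty := by
  obtain ⟨a, ha⟩ := hne
  obtain ⟨N, -, -, hNO, hN⟩ := hU a O hO ha
  exact hN.nonempty.mono (Set.inter_subset_inter_left _ hNO)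

/-- Since `U` is dense, `N` lies between the connected set `N ∩ U` and its closure. -/
theorem HasLocallyConnectedTrace.locallyConnectedSpace : LocallyConnectedSpace E := by
  rw [locallyConnectedSpace_iff_subsets_isOpen_isConnected]
  intro a O hO
  obtain ⟨O', hO'O, hO', ha⟩ := mem_nhds_iff.1 hO
  obtain ⟨N, hN, haN, hNO, hc⟩ := hU a O' hO' ha
  refine ⟨N, hNO.trans hO'O, hN, haN, hc.isConnected.subset_closure Set.inter_subset_left ?_⟩
  intro b hb
  rw [mem_closure_iff]
  intro Q hQ hbQ
  obtain ⟨c, hc, hcU⟩ := hU.inter_nonempty (hQ.inter hN) ⟨b, hbQ, hb⟩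
  exact ⟨c, hc.1, hc.2, hcU⟩

/-- Near each point of `W`, either all points of `U` can be joined to `c` within `W ∩ U` or none
can. The two cases define open sets covering `W`, disjoint by density of `U`, so connectedness of
`W` leaves only the first. -/
theorem HasLocallyConnectedTrace.isPathConnected_inter {W : Set E} (hW : IsOpen W)
    (hc : IsConnected W) : IsPathConnected (W ∩ U) := by
  obtain ⟨c, hc'⟩ := hU.inter_nonempty hW hc.nonempty
  refine ⟨c, hc', ?_⟩
  let D : Set E := {a | ∃ N, IsOpen N ∧ a ∈ N ∧ N ⊆ W ∧ ∀ b ∈ N ∩ U, JoinedIn (W ∩ U) c b}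
  let D' : Set E := {a | ∃ N, IsOpen N ∧ a ∈ N ∧ N ⊆ W ∧ ∀ b ∈ N ∩ U, ¬ JoinedIn (W ∩ U) c b}
  have hD : IsOpen D := isOpen_iff_forall_mem_open.2 fun a ⟨N, hN, ha, h⟩ =>
    ⟨N, fun b hb => ⟨N, hN, hb, h⟩, hN, ha⟩
  have hD' : IsOpen D' := isOpen_iff_forall_mem_open.2 fun a ⟨N, hN, ha, h⟩ =>
    ⟨N, fun b hb => ⟨N, hN, hb, h⟩, hN, ha⟩
  have hdis : Disjoint D D' := by
    rw [Set.disjoint_left]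
    rintro a ⟨N, hN, ha, -, h⟩ ⟨N', hN', ha', -, h'⟩
    obtain ⟨b, hb, hbU⟩ := hU.inter_nonempty (hN.inter hN') ⟨a, ha, ha'⟩
    exact h' b ⟨hb.2, hbU⟩ (h b ⟨hb.1, hbU⟩)
  have hcover : W ⊆ D ∪ D' := by
    intro a ha
    obtain ⟨N, hN, haN, hNW, hpc⟩ := hU a W hW ha
    have hsub : N ∩ U ⊆ W ∩ U := Set.inter_subset_inter_left _ hNW
    obtain ⟨b, hb⟩ := hpc.nonempty
    by_cases h : JoinedIn (W ∩ U) c b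
    · exact Or.inl ⟨N, hN, haN, hNW, fun b' hb' => h.trans ((hpc.joinedIn b hb b' hb').mono hsub)⟩
    · exact Or.inr ⟨N, hN, haN, hNW, fun b' hb' h' =>
        h (h'.trans ((hpc.joinedIn b' hb' b hb).mono hsub))⟩
  have hcD : c ∈ D := by
    rcases hcover hc'.1 with h | ⟨N, hN, ha, -, h⟩
    · exact h
    · exact (h c ⟨ha, hc'.2⟩ (JoinedIn.refl hc')).elim
  have hWD : W ⊆ D :=
    hc.isPreconnected.subset_left_of_subset_union hD hD' hdis hcover ⟨c, hc'.1, hcD⟩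
  intro b hb
  obtain ⟨N, -, hbN, -, h⟩ := hWD hb.1
  exact h b ⟨hbN, hb.2⟩

end Trace

/-! ### From path components to the monodromy statement -/

section FiniteQuotient

variable {E T G : Type*} [TopologicalSpace E] [TopologicalSpace T] [Group G] [MulAction G E]
  {p : E → T} (hp : IsSeparatedQuotient G p) {A : Set E}

include hp in
theorem IsSeparatedQuotient.joinedIn_smul (hA : ∀ (g : G), ∀ a ∈ A, g • a ∈ A) (g : G) {a b : E}
    (h : JoinedIn A a b) : JoinedIn A (g • a) (g • b) := by
  obtain ⟨γ, hγ⟩ := h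
  exact ⟨γ.map (hp.continuous_smul g), fun t => hA g _ (hγ t)⟩

include hp in
theorem IsSeparatedQuotient.pathTransporter_eq_of_joinedIn (hA : ∀ (g : G), ∀ a ∈ A, g • a ∈ A)
    {a b : E} (h : JoinedIn A a b) : pathTransporter G A a = pathTransporter G A b :=
  Set.ext fun g => ⟨fun hg => (h.symm.trans hg).trans (hp.joinedIn_smul hA g h),
    fun hg => (h.trans hg).trans (hp.joinedIn_smul hA g h.symm)⟩

include hp in
theorem IsSeparatedQuotient.pathTransporter_smul (hA : ∀ (g : G), ∀ a ∈ A, g • a ∈ A)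
    {a : E} {K : Subgroup G} (hK : pathTransporter G A a = K) (h : G) :
    pathTransporter G A (h • a) = (K.map (MulAut.conj h).toMonoidHom : Set G) := by
  ext g
  have h1 : g ∈ pathTransporter G A (h • a) ↔ h⁻¹ * g * h ∈ pathTransporter G A a := by
    constructor
    · intro hg
      have := hp.joinedIn_smul hA h⁻¹ hg
      rw [inv_smul_smul] at this
      simpa [pathTransporter, mul_smul] using this
    · intro hg
      have := hp.joinedIn_smul hA h hg
      simpa [pathTransporter, mul_smul] using this
  rw [h1, hK]
  simp only [SetLike.mem_coe, Subgroup.mem_map]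
  constructor
  · intro hg
    exact ⟨_, hg, by simp [mul_assoc]⟩
  · rintro ⟨k, hk, rfl⟩
    simpa [mul_assoc] using hk

include hp in
/-- A criterion for `LocalMonodromyEq` in terms of the path components of the preimage. -/
theorem IsSeparatedQuotient.localMonodromyEq [Finite G] {U : Set E} (hU : IsFreeOpen G U)
    {W : Set T} {K : Subgroup G} {u₀ : E} (hu₀ : u₀ ∈ U ∩ p ⁻¹' W)
    (hK : pathTransporter G (U ∩ p ⁻¹' W) u₀ = K)
    (hconj : ∀ u ∈ U ∩ p ⁻¹' W, ∃ h : G, JoinedIn (U ∩ p ⁻¹' W) (h • u₀) u) :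
    LocalMonodromyEq p U W K := by
  have hA : ∀ (g : G), ∀ a ∈ U ∩ p ⁻¹' W, g • a ∈ U ∩ p ⁻¹' W := fun g a ha =>
    ⟨hU.smul_mem g a ha.1, by simpa [hp.apply_smul] using ha.2⟩
  refine ⟨fun w u δ => ?_, ⟨p u₀, hu₀.2, u₀, hu₀.1, rfl⟩, ⟨u₀, hu₀.1⟩, Path.refl _, ?_⟩
  · obtain ⟨u', hpu', -, heq⟩ := exists_localMonodromy_eq hp hU W w u δ
    obtain ⟨h, hh⟩ := hconj u' ⟨u'.2, by simpa [hpu'] using w.2.1⟩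
    exact ⟨h, by rw [heq, ← hp.pathTransporter_eq_of_joinedIn hA hh, hp.pathTransporter_smul hA hK]⟩
  · obtain ⟨u', hpu', huniq, heq⟩ := exists_localMonodromy_eq hp hU W
      ⟨p u₀, hu₀.2, u₀, hu₀.1, rfl⟩ ⟨u₀, hu₀.1⟩ (Path.refl _)
    -- For the constant path `δ` the lift is constant, so the uniqueness clause identifies `u'` with
    -- `u₀`.
    rw [heq, ← huniq ⟨u₀, hu₀.1⟩ (Path.refl _) fun t => rfl]
    exact hK

end FiniteQuotient

/-! ### Preimages of neighborhoods in a slice -/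

section FiniteQuotient

variable {E T G : Type*} [TopologicalSpace E] [TopologicalSpace T] [Group G] [MulAction G E]

/-- A slice at `x`: an open neighborhood stable under the stabilizer of `x` and disjoint from its
other translates. -/
structure IsSlice (G : Type*) [Group G] [MulAction G E] (x : E) (O : Set E) : Prop where
  isOpen : IsOpen O
  mem : x ∈ O
  smul_mem : ∀ g : G, g • x = x → ∀ a ∈ O, g • a ∈ O
  smul_notMem : ∀ g : G, g • x ≠ x → ∀ a ∈ O, g • a ∉ O

variable {p : E → T} (hp : IsSeparatedQuotient G p) {x : E} {O : Set E} (hO : IsSlice G x O)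
include hp hO

/-- Two points of `O` with the same image differ by an element of `G_x`. A `G_x`-saturated clopen
part of `A` and its complement therefore have disjoint open images covering the connected set `B`,
and `x` is the only point of `O` over `p x`. -/
theorem IsSlice.isConnected_inter [LocallyConnectedSpace E] {B : Set T} (hB : IsOpen B)
    (hBc : IsConnected B) (hxB : p x ∈ B) (hBO : B ⊆ p '' O) : IsConnected (O ∩ p ⁻¹' B) := by
  set A := O ∩ p ⁻¹' B with hA
  have hAo : IsOpen A := hO.isOpen.inter (hB.preimage hp.continuous)
  have hxA : x ∈ A := ⟨hO.mem, hxB⟩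
  have hAs : ∀ g : G, g • x = x → ∀ a ∈ A, g • a ∈ A := fun g hg a ha =>
    ⟨hO.smul_mem g hg a ha.1, by simpa only [Set.mem_preimage, hp.apply_smul] using ha.2⟩
  suffices h : ∀ a ∈ A, x ∈ connectedComponentIn A a by
    have : connectedComponentIn A x = A := by
      refine (connectedComponentIn_subset A x).antisymm fun a ha => ?_
      rw [← connectedComponentIn_eq (h a ha)]
      exact mem_connectedComponentIn ha
    rw [← this]
    exact isConnected_connectedComponentIn_iff.2 hxA
  intro a ha
  set C := connectedComponentIn A a
  have hC : IsOpen C := hAo.connectedComponentIn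
  -- The `G_x`-saturation of `C`; its complement in `A` is a union of components, hence open.
  let C' : Set E := ⋃ h : MulAction.stabilizer G x, A ∩ (fun b => (h : G) • b) ⁻¹' C
  have hC' : IsOpen C' := isOpen_iUnion fun h => hAo.inter (hC.preimage (hp.continuous_smul h))
  have hC'A : C' ⊆ A := Set.iUnion_subset fun h => Set.inter_subset_left
  have haC' : a ∈ C' := Set.mem_iUnion.2 ⟨1, ha, by
    simpa using mem_connectedComponentIn ha⟩
  have hD : IsOpen (A \ C') := by
    refine isOpen_iff_forall_mem_open.2 fun b hb => ⟨connectedComponentIn A b, ?_,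
      hAo.connectedComponentIn, mem_connectedComponentIn hb.1⟩
    intro c hc
    refine ⟨connectedComponentIn_subset A b hc, fun hcC => hb.2 ?_⟩
    obtain ⟨h, hcA, hch⟩ := Set.mem_iUnion.1 hcC
    refine Set.mem_iUnion.2 ⟨h, hb.1, ?_⟩
    have himg : _root_.IsPreconnected ((fun b => (h : G) • b) '' connectedComponentIn A b) :=
      isPreconnected_connectedComponentIn.image _ (hp.continuous_smul h).continuousOn
    have hsub : (fun b => (h : G) • b) '' connectedComponentIn A b ⊆ A := by
      rintro _ ⟨d, hd, rfl⟩
      exact hAs h h.2 d (connectedComponentIn_subset A b hd)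
    have := himg.subset_connectedComponentIn ⟨c, hc, rfl⟩ hsub
      ⟨b, mem_connectedComponentIn hb.1, rfl⟩
    have hch' : (h : G) • c ∈ connectedComponentIn A a := hch
    rw [← connectedComponentIn_eq hch'] at this
    exact this
  have hdis : Disjoint (p '' C') (p '' (A \ C')) := by
    rw [Set.disjoint_left]
    rintro _ ⟨b, hb, rfl⟩ ⟨b', hb', heq⟩
    obtain ⟨g, rfl⟩ := (hp.eq_iff _ _).1 heq
    have hg : g • x = x := by
      by_contra hg
      exact hO.smul_notMem g hg b' hb'.1.1 (hC'A hb).1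
    obtain ⟨h, -, hh⟩ := Set.mem_iUnion.1 hb
    exact hb'.2 (Set.mem_iUnion.2 ⟨h * ⟨g, hg⟩, hb'.1, by simpa [mul_smul] using hh⟩)
  have hcover : B ⊆ p '' C' ∪ p '' (A \ C') := by
    intro t ht
    obtain ⟨b, hb, rfl⟩ := hBO ht
    by_cases hbC : b ∈ C'
    · exact Or.inl ⟨b, hbC, rfl⟩
    · exact Or.inr ⟨b, ⟨⟨hb, ht⟩, hbC⟩, rfl⟩
  obtain ⟨b, hb, hbx⟩ := hBc.isPreconnected.subset_left_of_subset_union (hp.isOpenMap _ hC')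
    (hp.isOpenMap _ hD) hdis hcover ⟨p a, ha.2, a, haC', rfl⟩ hxB
  obtain ⟨g, hg⟩ := (hp.eq_iff _ _).1 hbx.symm
  have hgx : g • x = x := by
    by_contra hgx
    exact hO.smul_notMem g hgx x hO.mem (hg ▸ (hC'A hb).1)
  obtain ⟨h, -, hh⟩ := Set.mem_iUnion.1 hb
  have hhx : (h : G) • x = x := h.2
  rw [Set.mem_preimage, ← hg, hgx, hhx] at hh
  exact hh

omit hO in
theorem IsSeparatedQuotient.exists_smul_mem_of_subset_image {B : Set T} (hBO : B ⊆ p '' O) {a : E} (ha : a ∈ p ⁻¹' B) :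
    ∃ (h : G) (b : E), b ∈ O ∩ p ⁻¹' B ∧ h • b = a := by
  obtain ⟨b, hb, hba⟩ := hBO ha
  obtain ⟨h, rfl⟩ := (hp.eq_iff _ _).1 hba
  exact ⟨h, b, ⟨hb, by rw [Set.mem_preimage, hba]; exact ha⟩, rfl⟩

/-- Over `B` every point lies in `O` or in `Q`, the union of the translates of `O` by elements
outside `G_x`. These open sets are disjoint, so a path starting in `O` stays there, and `g • u ∈ O`
forces `g ∈ G_x`. -/
theorem IsSlice.pathTransporter_eq {U : Set E} {B : Set T} (hBO : B ⊆ p '' O)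
    (hc : IsPathConnected (O ∩ p ⁻¹' B ∩ U)) (hU : IsFreeOpen G U) {u : E}
    (hu : u ∈ O ∩ p ⁻¹' B ∩ U) :
    pathTransporter G (U ∩ p ⁻¹' B) u = MulAction.stabilizer G x := by
  ext g
  simp only [SetLike.mem_coe, MulAction.mem_stabilizer_iff]
  constructor
  · rintro ⟨γ, hγ⟩
    by_contra hg
    let Q : Set E := ⋃ h : {h : G // h • x ≠ x}, (fun a => (h : G)⁻¹ • a) ⁻¹' O
    have hQ : IsOpen Q := isOpen_iUnion fun h => hO.isOpen.preimage (hp.continuous_smul _)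
    have hdis : Disjoint O Q := by
      rw [Set.disjoint_left]
      intro a ha haQ
      obtain ⟨h, hh⟩ := Set.mem_iUnion.1 haQ
      exact hO.smul_notMem h h.2 _ hh (by simpa using ha)
    have hcover : Set.range γ ⊆ O ∪ Q := by
      rintro _ ⟨t, rfl⟩
      obtain ⟨h, b, hb, hba⟩ := hp.exists_smul_mem_of_subset_image hBO (hγ t).2
      by_cases hh : h • x = x
      · exact Or.inl (hba ▸ hO.smul_mem h hh b hb.1)
      · exact Or.inr (Set.mem_iUnion.2 ⟨⟨h, hh⟩, by simpa [← hba] using hb.1⟩)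
    have := (isPreconnected_range γ.continuous).subset_left_of_subset_union hO.isOpen hQ hdis hcover
      ⟨u, ⟨0, γ.source⟩, hu.1.1⟩ ⟨1, γ.target⟩
    exact hO.smul_notMem g hg u hu.1.1 this
  · intro hg
    refine (hc.joinedIn u hu _ ?_).mono fun a ha => ⟨ha.2, ha.1.2⟩
    exact ⟨⟨hO.smul_mem g hg u hu.1.1, by simpa [hp.apply_smul] using hu.1.2⟩, hU.smul_mem g u hu.2⟩

/-- For connected open `B` in the image of a slice the preimage has the expected components. -/
theorem IsSlice.pathTransporter_eq_and_exists {U : Set E} (hU : IsFreeOpen G U)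
    (hT : HasLocallyConnectedTrace U) {B : Set T} (hB : IsOpen B) (hBc : IsConnected B)
    (hxB : p x ∈ B) (hBO : B ⊆ p '' O) {u : E} (hu : u ∈ O ∩ p ⁻¹' B ∩ U) :
    pathTransporter G (U ∩ p ⁻¹' B) u = MulAction.stabilizer G x ∧
      ∀ u' ∈ U ∩ p ⁻¹' B, ∃ h : G, JoinedIn (U ∩ p ⁻¹' B) (h • u) u' := by
  have := hT.locallyConnectedSpace
  have hc : IsPathConnected (O ∩ p ⁻¹' B ∩ U) := hT.isPathConnected_inter
    (hO.isOpen.inter (hB.preimage hp.continuous)) (hO.isConnected_inter hp hB hBc hxB hBO)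
  refine ⟨hO.pathTransporter_eq hp hBO hc hU hu, fun u' hu' => ?_⟩
  obtain ⟨h, b, hb, rfl⟩ := hp.exists_smul_mem_of_subset_image hBO hu'.2
  have hbU : b ∈ U := by simpa using hU.smul_mem h⁻¹ _ hu'.1
  refine ⟨h, hp.joinedIn_smul (A := U ∩ p ⁻¹' B) (fun g a ha => ⟨hU.smul_mem g a ha.1, ?_⟩) h
    ((hc.joinedIn u hu b ⟨hb, hbU⟩).mono fun a ha => ⟨ha.2, ha.1.2⟩)⟩
  simpa [hp.apply_smul] using ha.2

theorem IsSlice.localMonodromyEq [Finite G] {U : Set E} (hU : IsFreeOpen G U)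
    (hT : HasLocallyConnectedTrace U) {B : Set T} (hB : IsOpen B) (hBc : IsConnected B)
    (hxB : p x ∈ B) (hBO : B ⊆ p '' O) :
    LocalMonodromyEq p U B (MulAction.stabilizer G x) := by
  obtain ⟨u, hu⟩ := hT.inter_nonempty (hO.isOpen.inter (hB.preimage hp.continuous))
    ⟨x, hO.mem, hxB⟩
  obtain ⟨h1, h2⟩ := hO.pathTransporter_eq_and_exists hp hU hT hB hBc hxB hBO hu
  exact hp.localMonodromyEq hU ⟨hu.2, hu.1.2⟩ h1 h2

/-- A good neighborhood need not be connected or lie in the image of the slice. A connected open `p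
'' D` is squeezed between two members of the system, and the homotopy equivalence transfers both
transporter and transitivity. -/
theorem IsSlice.localMonodromyEq_of_isGoodNeighborhood [Finite G] {U : Set E}
    (hU : IsFreeOpen G U) (hT : HasLocallyConnectedTrace U) {W : Set T}
    (hW : IsGoodNeighborhood (p '' U)ᶜ (p x) W) :
    LocalMonodromyEq p U W (MulAction.stabilizer G x) := by
  obtain ⟨𝒰, h𝒰, hW⟩ := hW
  have := hT.locallyConnectedSpace
  have cov := hp.isCoveringMap hU
  have hQo : IsOpen (W ∩ p '' O) := (h𝒰.isOpen W hW).inter (hp.isOpenMap _ hO.isOpen)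
  have hxQ : x ∈ p ⁻¹' (W ∩ p '' O) := ⟨h𝒰.mem W hW, x, hO.mem, rfl⟩
  -- The component is taken upstairs, where local connectedness is known; the open map `p` sends it
  -- to a connected open set.
  set D := connectedComponentIn (p ⁻¹' (W ∩ p '' O)) x with hD
  have hDo : IsOpen D := (hQo.preimage hp.continuous).connectedComponentIn
  have hDQ : p '' D ⊆ W ∩ p '' O := by
    rintro _ ⟨a, ha, rfl⟩
    exact connectedComponentIn_subset (p ⁻¹' (W ∩ p '' O)) x ha
  have hBo : IsOpen (p '' D) := hp.isOpenMap _ hDo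
  have hBc : IsConnected (p '' D) :=
    (isConnected_connectedComponentIn_iff.2 hxQ).image _ hp.continuous.continuousOn
  have hxB : p x ∈ p '' D := ⟨x, mem_connectedComponentIn hxQ, rfl⟩
  obtain ⟨W', hW', hW'B⟩ := h𝒰.cofinal _ hBo hxB
  have hW'W : W' ⊆ W := hW'B.trans (hDQ.trans Set.inter_subset_left)
  obtain ⟨u, ⟨huO, huW'⟩, huU⟩ := hT.inter_nonempty
    (hO.isOpen.inter ((h𝒰.isOpen W' hW').preimage hp.continuous)) ⟨x, hO.mem, h𝒰.mem W' hW'⟩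
  obtain ⟨h1, h2⟩ := hO.pathTransporter_eq_and_exists hp hU hT hBo hBc hxB
    (hDQ.trans Set.inter_subset_right) ⟨⟨huO, hW'B huW'⟩, huU⟩
  obtain ⟨e, he⟩ := h𝒰.homotopyEquiv W hW W' hW' hW'W
  have heq : ∀ a, (e.toFun a : T) = a := fun a => by rw [he]; rfl
  have hsub : U ∩ p ⁻¹' (p '' D) ⊆ U ∩ p ⁻¹' W := fun a ha => ⟨ha.1, (hDQ ha.2).1⟩
  have hsub' : U ∩ p ⁻¹' W' ⊆ U ∩ p ⁻¹' (p '' D) := fun a ha => ⟨ha.1, hW'B ha.2⟩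
  have hmem : ∀ {Q : Set T} {t : T}, t ∈ Q \ (p '' U)ᶜ → t ∈ p '' U := fun h => by
    by_contra h'; exact h.2 h'
  let incl : (Q : Set T) → ↥(Q \ (p '' U)ᶜ) → ↥(p '' U) := fun Q t => ⟨t, hmem t.2⟩
  have hincl : ∀ Q, Continuous (incl Q) := fun Q => continuous_subtype_val.subtype_mk _
  refine hp.localMonodromyEq hU (u₀ := u) ⟨huU, hW'W huW'⟩ ?_ ?_
  · rw [← h1]
    refine Set.Subset.antisymm ?_ fun g hg => JoinedIn.mono hg hsub
    rintro g ⟨Γ, hΓ⟩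
    let a : ↥(W' \ (p '' U)ᶜ) := ⟨p u, huW', fun h => h ⟨u, huU, rfl⟩⟩
    have ha : (e.toFun a : T) = p u := heq a
    let γ : Path (e.toFun a) (e.toFun a) :=
      { toFun := fun t => ⟨p (Γ t), (hΓ t).2, fun h => h ⟨_, (hΓ t).1, rfl⟩⟩
        continuous_toFun := (hp.continuous.comp Γ.continuous).subtype_mk _
        source' := Subtype.ext (by simp [ha])
        target' := Subtype.ext (by simp [ha, hp.apply_smul]) }
    obtain ⟨γ₀, hγ₀⟩ := exists_loop_of_homotopyEquiv e a γ
    let Γ₁ : Path (⟨u, huU⟩ : U) ⟨g • u, hU.smul_mem g u huU⟩ :=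
      { toFun := fun t => ⟨Γ t, (hΓ t).1⟩
        continuous_toFun := Γ.continuous.subtype_mk _
        source' := Subtype.ext (by simp)
        target' := Subtype.ext (by simp) }
    -- The projected loop `γ` is homotopic in `W \ Z` to a loop from `W' \ Z`. The lift of the
    -- latter has the same endpoint `g • u` and stays over `W'`.
    obtain ⟨u', Γ₀, hΓ₀⟩ := cov.exists_path_lift (e := (⟨u, huU⟩ : U))
      ((γ₀.map e.toFun.continuous).map (hincl W)) (Subtype.ext ha.symm)
    have hend := cov.endpoint_eq Γ₀ Γ₁ _ (γ.map (hincl W)) hΓ₀ (fun t => rfl)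
      (hγ₀.map ⟨incl W, hincl W⟩)
    subst hend
    have hΓ₀W : ∀ t, p (Γ₀ t) ∈ W' := fun t => ?_
    · exact JoinedIn.mono (U := U ∩ p ⁻¹' W')
        ⟨Γ₀.map continuous_subtype_val, fun t => ⟨(Γ₀ t).2, hΓ₀W t⟩⟩ hsub'
    have := congrArg Subtype.val (hΓ₀ t)
    rw [show p (Γ₀ t) = _ from this]
    change (e.toFun (γ₀ t) : T) ∈ W'
    rw [heq]
    exact (γ₀ t).2.1
  · intro u' hu'
    -- A path in `W \ Z` ending in `W' \ Z` is lifted from `u'`; at its end transitivity over `p ''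
    -- D` applies.
    obtain ⟨a, ⟨γ⟩⟩ := exists_joined_of_homotopyEquiv e ⟨p u', hu'.2, fun h => h ⟨u', hu'.1, rfl⟩⟩
    obtain ⟨v, Γ, hΓ⟩ := cov.exists_path_lift (e := (⟨u', hu'.1⟩ : U)) (γ.map (hincl W)) rfl
    have hΓW : ∀ t, p (Γ t) = γ t := fun t => congrArg Subtype.val (hΓ t)
    have hv : p v = a := by
      have := hΓW 1
      rw [Γ.target, γ.target, heq] at this
      exact this
    have hj : JoinedIn (U ∩ p ⁻¹' W) u' v := ⟨Γ.map continuous_subtype_val, fun t =>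
      ⟨(Γ t).2, by
        change p (Γ t) ∈ W
        rw [hΓW]; exact (γ t).2.1⟩⟩
    obtain ⟨h, hh⟩ := h2 v (hsub' ⟨v.2, by rw [Set.mem_preimage, hv]; exact a.2.1⟩)
    exact ⟨h, (hh.mono hsub).trans hj.symm⟩

end FiniteQuotient

/-- The topological form of the theorem. -/
theorem localMonodromyEq_stabilizer {E T G : Type*} [TopologicalSpace E] [TopologicalSpace T]
    [Group G] [Finite G] [MulAction G E] {p : E → T} (hp : IsSeparatedQuotient G p) {U : Set E}
    (hU : IsFreeOpen G U) (hT : HasLocallyConnectedTrace U) (x : E) :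
    (∀ W : Set T, IsGoodNeighborhood (p '' U)ᶜ (p x) W →
      LocalMonodromyEq p U W (MulAction.stabilizer G x)) ∧
    ∃ N : Set T, IsOpen N ∧ p x ∈ N ∧ ∀ B : Set T, IsOpen B → IsConnected B → p x ∈ B → B ⊆ N →
      LocalMonodromyEq p U B (MulAction.stabilizer G x) := by
  obtain ⟨O, h1, h2, h3, h4⟩ := hp.exists_slice (G := G) x
  have hO : IsSlice G x O := ⟨h1, h2, h3, h4⟩
  exact ⟨fun W hW => hO.localMonodromyEq_of_isGoodNeighborhood hp hU hT hW, p '' O,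
    hp.isOpenMap _ h1, ⟨x, h2, rfl⟩, fun B hB hBc hxB hBN =>
      hO.localMonodromyEq hp hU hT hB hBc hxB hBN⟩

noncomputable section

/-! ### Complex points of algebras -/

section AlgebraPoints

variable {A : Type*} [CommRing A] [Algebra ℂ A]

/-- The topology of pointwise convergence on the complex points of an algebra. -/
instance algPointTopology : TopologicalSpace (A →ₐ[ℂ] ℂ) :=
  TopologicalSpace.induced (fun φ => (φ : A → ℂ)) inferInstance

theorem continuous_algPoint_iff {S : Type*} [TopologicalSpace S] {f : S → (A →ₐ[ℂ] ℂ)} :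
    Continuous f ↔ ∀ a, Continuous fun s => f s a :=
  continuous_induced_rng.trans continuous_pi_iff

theorem continuous_algPoint_apply (a : A) : Continuous fun φ : A →ₐ[ℂ] ℂ => φ a :=
  (continuous_apply a).comp continuous_induced_dom

theorem tendsto_algPoint_iff {S : Type*} {l : Filter S} {f : S → (A →ₐ[ℂ] ℂ)} {φ : A →ₐ[ℂ] ℂ} :
    Filter.Tendsto f l (𝓝 φ) ↔ ∀ a, Filter.Tendsto (fun s => f s a) l (𝓝 (φ a)) := by
  rw [(IsInducing.induced (fun φ : A →ₐ[ℂ] ℂ => (φ : A → ℂ))).tendsto_nhds_iff, tendsto_pi_nhds]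
  rfl

theorem continuousOn_algPoint_iff {S : Type*} [TopologicalSpace S] {f : S → (A →ₐ[ℂ] ℂ)}
    {s : Set S} : ContinuousOn f s ↔ ∀ a, ContinuousOn (fun z => f z a) s := by
  simp only [ContinuousOn, ContinuousWithinAt, tendsto_algPoint_iff]
  exact ⟨fun h a z hz => h z hz a, fun h z hz a => h a z hz⟩

end AlgebraPoints

/-! ### Differentiability of polynomial functions -/

section Polynomial

variable {ι : Type*} [Fintype ι]

theorem hasStrictFDerivAt_aeval (q : MvPolynomial ι ℂ) (v : ι → ℂ) :
    HasStrictFDerivAt (fun u : ι → ℂ => MvPolynomial.aeval u q)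
      (∑ i, MvPolynomial.aeval v (MvPolynomial.pderiv i q) •
        (ContinuousLinearMap.proj i : (ι → ℂ) →L[ℂ] ℂ)) v := by
  classical
  induction q using MvPolynomial.induction_on with
  | C a =>
    simp only [MvPolynomial.aeval_C]
    exact (hasStrictFDerivAt_const (𝕜 := ℂ) _ v).congr_fderiv (by ext; simp)
  | add q r hq hr =>
    simp only [map_add]
    exact (hq.fun_add hr).congr_fderiv (by ext; simp [add_mul, Finset.sum_add_distrib])
  | mul_X q j hq =>
    simp only [map_mul, MvPolynomial.aeval_X]
    refine (hq.mul (ContinuousLinearMap.proj j : (ι → ℂ) →L[ℂ] ℂ).hasStrictFDerivAt).congr_fderiv ?_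
    ext u
    simp only [MvPolynomial.pderiv_mul, MvPolynomial.pderiv_X, map_add, map_mul,
      MvPolynomial.aeval_X, _root_.add_apply, _root_.smul_apply,
      _root_.sum_apply, ContinuousLinearMap.proj_apply, smul_eq_mul, add_mul,
      Finset.sum_add_distrib, Finset.mul_sum]
    rw [add_comm]
    congr 1
    · refine Finset.sum_congr rfl fun i _ => ?_
      ring
    · rw [Finset.sum_eq_single j]
      · simp
      · intro i _ hij
        simp [hij.symm]
      · simp

theorem contDiff_aeval {n : WithTop ℕ∞} (q : MvPolynomial ι ℂ) :
    ContDiff ℂ n (fun u : ι → ℂ => MvPolynomial.aeval u q) := by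
  induction q using MvPolynomial.induction_on with
  | C a => simpa using contDiff_const
  | add q r hq hr => simpa using hq.add hr
  | mul_X q j hq =>
    simp only [map_mul, MvPolynomial.aeval_X]
    exact hq.mul (contDiff_apply ℂ ℂ j)

end Polynomial

/-! ### Complex points of a submersive presentation -/

section Chart

open MvPolynomial

variable {A : Type*} [CommRing A] [Algebra ℂ A] {ι σ : Type*} [Finite σ]
  (P : Algebra.SubmersivePresentation ℂ A ι σ)

theorem algPoint_ext {φ ψ : A →ₐ[ℂ] ℂ} (h : ∀ i, φ (P.val i) = ψ (P.val i)) : φ = ψ := by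
  ext a
  obtain ⟨q, rfl⟩ := P.aeval_val_surjective a
  have : φ.comp (aeval P.val) = ψ.comp (aeval P.val) := MvPolynomial.algHom_ext fun i => by
    simpa using h i
  exact DFunLike.congr_fun this q

theorem algPoint_aeval (φ : A →ₐ[ℂ] ℂ) (q : MvPolynomial ι ℂ) :
    φ (aeval P.val q) = aeval (fun i => φ (P.val i)) q := by
  rw [← MvPolynomial.comp_aeval_apply]

/-- The relations generate the kernel of the presentation, so evaluation at a common zero descends
to `A`. -/
theorem exists_algPoint {v : ι → ℂ} (hv : ∀ j, aeval v (P.relation j) = 0) :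
    ∃ φ : A →ₐ[ℂ] ℂ, ∀ i, φ (P.val i) = v i := by
  have hker : ∀ q ∈ RingHom.ker (aeval P.val : MvPolynomial ι ℂ →ₐ[ℂ] A), aeval v q = 0 := by
    have : RingHom.ker (aeval P.val : MvPolynomial ι ℂ →ₐ[ℂ] A) ≤
        RingHom.ker (aeval v : MvPolynomial ι ℂ →ₐ[ℂ] ℂ) := by
      rw [← P.ker_eq_ker_aeval_val, ← P.span_range_relation_eq_ker, Ideal.span_le]
      rintro _ ⟨j, rfl⟩
      exact hv j
    exact fun q hq => this hq
  let e := Ideal.quotientKerAlgEquivOfSurjective (f := (aeval P.val : MvPolynomial ι ℂ →ₐ[ℂ] A)) P.aeval_val_surjective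
  refine ⟨(Ideal.Quotient.liftₐ _ (aeval v) hker).comp e.symm.toAlgHom, fun i => ?_⟩
  have : e.symm (P.val i) = Ideal.Quotient.mk _ (X i) := by
    rw [AlgEquiv.symm_apply_eq]
    simp [e]
  change Ideal.Quotient.liftₐ _ (aeval v) hker (e.symm (P.val i)) = v i
  rw [this]
  simp [Ideal.Quotient.liftₐ_apply]

/-- The defining equations, completed by the free coordinates. -/
def chartPolynomial (i : ι) : MvPolynomial ι ℂ :=
  Function.extend P.map P.relation X i

theorem chartPolynomial_map (j : σ) : chartPolynomial P (P.map j) = P.relation j :=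
  P.map_inj.extend_apply _ _ _

theorem chartPolynomial_of_notMem {i : ι} (hi : i ∉ Set.range P.map) : chartPolynomial P i = X i :=
  Function.extend_apply' _ _ _ hi

/-- The Jacobian is a unit of `A`, so its value at a complex point is a nonzero determinant. -/
theorem eq_zero_of_jacobian (φ : A →ₐ[ℂ] ℂ) [Fintype σ] {w : σ → ℂ}
    (hw : ∀ j, ∑ k, aeval (fun i => φ (P.val i)) (pderiv (P.map k) (P.relation j)) * w k = 0) :
    w = 0 := by
  classical
  let M : Matrix σ σ ℂ := (aeval fun i => φ (P.val i)).toRingHom.mapMatrix P.jacobiMatrix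
  have hM : M.det ≠ 0 := by
    have h := P.jacobian_isUnit.map φ
    rw [P.jacobian_eq_jacobiMatrix_det, P.algebraMap_eq] at h
    change IsUnit (φ (aeval P.val P.jacobiMatrix.det)) at h
    rw [algPoint_aeval] at h
    have hdet : M.det = aeval (fun i => φ (P.val i)) P.jacobiMatrix.det :=
      (RingHom.map_det _ _).symm
    rw [hdet]
    exact h.ne_zero
  refine Matrix.eq_zero_of_vecMul_eq_zero hM (funext fun j => ?_)
  refine Eq.trans ?_ (hw j)
  simp only [Matrix.vecMul, dotProduct, M, RingHom.mapMatrix_apply, Matrix.map_apply]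
  refine Finset.sum_congr rfl fun k _ => ?_
  rw [P.jacobiMatrix_apply, mul_comm]
  rfl

end Chart

/-! ### Holomorphic charts from the inverse function theorem -/

section Chart

open MvPolynomial

variable {A : Type*} [CommRing A] [Algebra ℂ A] {ι σ : Type*} [Finite σ]
  (P : Algebra.SubmersivePresentation ℂ A ι σ)

/-- The free coordinates of a submersive presentation. -/
abbrev FreeIndex : Type _ := {i : ι // i ∉ Set.range P.map}

open Classical in
/-- Extension of free coordinates by zero. -/
def extendByZero (z : FreeIndex P → ℂ) (i : ι) : ℂ :=
  if h : i ∉ Set.range P.map then z ⟨i, h⟩ else 0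

/-- The map whose local inverse is the chart. -/
def chartMap (v : ι → ℂ) (i : ι) : ℂ := aeval v (chartPolynomial P i)

theorem chartMap_apply_val (φ : A →ₐ[ℂ] ℂ) :
    chartMap P (fun i => φ (P.val i)) = extendByZero P fun i => φ (P.val i) := by
  classical
  ext i
  unfold chartMap extendByZero
  by_cases h : i ∉ Set.range P.map
  · rw [dif_pos h, chartPolynomial_of_notMem P h, aeval_X]
  · rw [dif_neg h]
    obtain ⟨j, rfl⟩ := not_not.1 h
    rw [chartPolynomial_map, ← algPoint_aeval]
    exact (congrArg φ (P.aeval_val_relation j)).trans (map_zero φ)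

variable [Fintype ι]

instance : Fintype (FreeIndex P) := Fintype.ofFinite _

theorem contDiff_chartMap {n : WithTop ℕ∞} : ContDiff ℂ n (chartMap P) :=
  contDiff_pi.2 fun _ => contDiff_aeval _

theorem contDiff_extendByZero {n : WithTop ℕ∞} : ContDiff ℂ n (extendByZero P) := by
  classical
  refine contDiff_pi.2 fun i => ?_
  unfold extendByZero
  by_cases h : i ∉ Set.range P.map
  · simp only [dif_pos h]
    exact contDiff_apply ℂ ℂ (⟨i, h⟩ : FreeIndex P)
  · simp only [dif_neg h]
    exact contDiff_const

/-- The derivative is block triangular: the identity on free coordinates and the Jacobian on the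
others. It is therefore injective, hence invertible in finite dimension. -/
theorem exists_hasFDerivAt_chartMap (φ : A →ₐ[ℂ] ℂ) :
    ∃ F' : (ι → ℂ) ≃L[ℂ] (ι → ℂ),
      HasFDerivAt (chartMap P) (F' : (ι → ℂ) →L[ℂ] (ι → ℂ)) (fun i => φ (P.val i)) := by
  classical
  have := Fintype.ofFinite σ
  set v : ι → ℂ := fun i => φ (P.val i) with hv
  let L : (ι → ℂ) →L[ℂ] (ι → ℂ) := ContinuousLinearMap.pi fun k =>
    ∑ i, aeval v (pderiv i (chartPolynomial P k)) •
      (ContinuousLinearMap.proj i : (ι → ℂ) →L[ℂ] ℂ)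
  have hLk : ∀ w k, L w k = ∑ i, aeval v (pderiv i (chartPolynomial P k)) * w i := by
    intro w k
    simp [L]
  have hL : HasFDerivAt (chartMap P) L v :=
    hasFDerivAt_pi.2 fun k => (hasStrictFDerivAt_aeval _ v).hasFDerivAt
  have hinj : Function.Injective L := by
    rw [injective_iff_map_eq_zero]
    intro w hw
    have h0 : ∀ i ∉ Set.range P.map, w i = 0 := by
      intro i hi
      have := hLk w i
      rw [hw, chartPolynomial_of_notMem P hi, Finset.sum_eq_single i] at this
      · simpa using this.symm
      · intro k _ hk
        rw [pderiv_X_of_ne hk.symm, map_zero, zero_mul]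
      · simp
    have h1 : (fun k => w (P.map k)) = 0 := by
      refine eq_zero_of_jacobian P φ fun j => ?_
      have := hLk w (P.map j)
      rw [hw, chartPolynomial_map] at this
      rw [← Finset.sum_subset (Finset.subset_univ (Finset.univ.image P.map)) fun i _ hi => by
        rw [h0 i (by simpa using hi), mul_zero], Finset.sum_image P.map_inj.injOn] at this
      exact this.symm
    ext i
    by_cases hi : i ∈ Set.range P.map
    · obtain ⟨j, rfl⟩ := hi
      exact congrFun h1 j
    · exact h0 i hi
  exact ⟨(LinearEquiv.ofInjectiveEndo L.toLinearMap hinj).toContinuousLinearEquiv, hL⟩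

/-- A local parametrization of the complex points near a given point: a chart for which the values
of all elements are holomorphic. -/
structure IsParametrization {κ : Type*} [Fintype κ] (t : κ → A) (x : A →ₐ[ℂ] ℂ) (r : ℝ)
    (ψ : (κ → ℂ) → (A →ₐ[ℂ] ℂ)) : Prop where
  pos : 0 < r
  center : ψ (fun i => x (t i)) = x
  isOpen_image : ∀ s ≤ r, IsOpen (ψ '' Metric.ball (fun i => x (t i)) s)
  differentiableOn : ∀ a, DifferentiableOn ℂ (fun z => ψ z a) (Metric.ball (fun i => x (t i)) r)
  coord : ∀ z ∈ Metric.ball (fun i => x (t i)) r, ∀ i, ψ z (t i) = z i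

/-- The complex points go into the coordinate subspace under `chartMap`, so the local inverse of
`chartMap` on that subspace, read as a point of `A`, is the parametrization. -/
theorem exists_isParametrization (x : A →ₐ[ℂ] ℂ) :
    ∃ r ψ, IsParametrization (fun i : FreeIndex P => P.val i) x r ψ := by
  classical
  obtain ⟨F', hF'⟩ := exists_hasFDerivAt_chartMap P x
  set v : ι → ℂ := fun i => x (P.val i) with hv
  have hC : ContDiffAt ℂ 1 (chartMap P) v := (contDiff_chartMap P).contDiffAt
  let e := hC.toOpenPartialHomeomorph _ hF' one_ne_zero
  have hev : v ∈ e.source := hC.mem_toOpenPartialHomeomorph_source hF' one_ne_zero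
  have he : ∀ u, e u = chartMap P u := fun u => rfl
  set z₀ : FreeIndex P → ℂ := fun i => x (P.val i) with hz₀
  have hcent : chartMap P v = extendByZero P z₀ := chartMap_apply_val P x
  have hsymm : ContDiffAt ℂ 1 e.symm (extendByZero P z₀) :=
    hcent ▸ hC.to_localInverse hF' one_ne_zero
  have hext : Continuous (extendByZero P) := (contDiff_extendByZero P (n := 1)).continuous
  have hev1 : ∀ᶠ z in 𝓝 z₀, extendByZero P z ∈ e.target :=
    hext.continuousAt.eventually (e.open_target.mem_nhds (hcent ▸ e.map_source hev))
  have hev2 : ∀ᶠ z in 𝓝 z₀, ContDiffAt ℂ 1 e.symm (extendByZero P z) :=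
    hext.continuousAt.eventually (hsymm.eventually (by simp))
  obtain ⟨r, hr, hball⟩ := Metric.eventually_nhds_iff_ball.1 (hev1.and hev2)
  have hex : ∀ z ∈ Metric.ball z₀ r, ∃ φ : A →ₐ[ℂ] ℂ,
      (fun i => φ (P.val i)) = e.symm (extendByZero P z) := by
    intro z hz
    obtain ⟨φ, hφ⟩ := exists_algPoint P (v := e.symm (extendByZero P z)) fun j => by
      have := congrFun (e.right_inv (hball z hz).1) (P.map j)
      rw [he] at this
      unfold chartMap at this
      rw [chartPolynomial_map] at this
      rw [this]
      simp [extendByZero]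
    exact ⟨φ, funext hφ⟩
  have : Nonempty (A →ₐ[ℂ] ℂ) := ⟨x⟩
  choose! ψ hψ using hex
  have hcoord : ∀ z ∈ Metric.ball z₀ r, ∀ i : FreeIndex P, ψ z (P.val i) = z i := by
    intro z hz i
    have h1 := congrFun (e.right_inv (hball z hz).1) i
    rw [he, ← hψ z hz, chartMap_apply_val] at h1
    simpa [extendByZero, i.2] using h1
  have huniq : ∀ z ∈ Metric.ball z₀ r, ∀ φ : A →ₐ[ℂ] ℂ, (fun i => φ (P.val i)) ∈ e.source →
      (fun i : FreeIndex P => φ (P.val i)) = z → ψ z = φ := by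
    rintro z hz φ hφ rfl
    refine algPoint_ext P fun i => ?_
    have h1 := congrFun (hψ _ hz) i
    rw [← chartMap_apply_val, ← he, e.left_inv hφ] at h1
    exact h1
  refine ⟨r, ψ, hr, huniq z₀ (Metric.mem_ball_self hr) x hev rfl, fun s hs => ?_, fun a => ?_, hcoord⟩
  · have himg : ψ '' Metric.ball z₀ s = (fun φ : A →ₐ[ℂ] ℂ => fun i => φ (P.val i)) ⁻¹' e.source ∩
        (fun φ : A →ₐ[ℂ] ℂ => fun i : FreeIndex P => φ (P.val i)) ⁻¹' Metric.ball z₀ s := by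
      ext φ
      constructor
      · rintro ⟨z, hz, rfl⟩
        have hz' := Metric.ball_subset_ball hs hz
        refine ⟨?_, ?_⟩
        · change (fun i => ψ z (P.val i)) ∈ e.source
          rw [hψ z hz']
          exact e.map_target (hball z hz').1
        · change (fun i : FreeIndex P => ψ z (P.val i)) ∈ Metric.ball z₀ s
          rw [funext (hcoord z hz')]
          exact hz
      · rintro ⟨h1, h2⟩
        exact ⟨_, h2, huniq _ (Metric.ball_subset_ball hs h2) φ h1 rfl⟩
    rw [himg]
    exact (e.open_source.preimage (continuous_pi fun i => continuous_algPoint_apply _)).inter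
      (Metric.isOpen_ball.preimage (continuous_pi fun i => continuous_algPoint_apply _))
  · obtain ⟨q, rfl⟩ := P.aeval_val_surjective a
    have : ∀ z ∈ Metric.ball z₀ r, ψ z (aeval P.val q) = aeval (e.symm (extendByZero P z)) q :=
      fun z hz => by rw [algPoint_aeval, hψ z hz]
    refine DifferentiableOn.congr (fun z hz => ?_) this
    refine DifferentiableAt.differentiableWithinAt ?_
    exact ((contDiff_aeval (n := 1) q).differentiable one_ne_zero _).comp z
      (((hball z hz).2.differentiableAt one_ne_zero).comp z
        ((contDiff_extendByZero P (n := 1)).differentiable one_ne_zero _))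

end Chart

/-! ### Avoiding countable sets in the plane -/

section Planar

/-- Join `0` to `1` by two segments through `1/2 + t * I`. A point of `Z` obstructs at most one real
`t` on each segment, so some small `t` is admissible. -/
theorem joinedIn_diff_countable {Ω Z : Set ℂ} (hΩ : IsOpen Ω) (hconv : Convex ℝ Ω) (h0 : (0 : ℂ) ∈ Ω)
    (h1 : (1 : ℂ) ∈ Ω) (hZ : Z.Countable) (hZ0 : (0 : ℂ) ∉ Z) (hZ1 : (1 : ℂ) ∉ Z) :
    JoinedIn (Ω \ Z) 0 1 := by
  let c : ℝ → ℂ := fun t => 1 / 2 + t * Complex.I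
  have hc : Continuous c := by fun_prop
  have hc0 : c 0 ∈ Ω := by
    have := hconv h0 h1 (a := 1 / 2) (b := 1 / 2) (by norm_num) (by norm_num) (by norm_num)
    simpa [c] using this
  -- The parameters `t` recovered from a point of `Z` by its slope seen from `0`, or seen from `1`.
  let B : Set ℝ := (fun z : ℂ => z.im / (2 * z.re)) '' Z ∪
    (fun z : ℂ => -(z - 1).im / (2 * (z - 1).re)) '' Z
  have hB : B.Countable := (hZ.image _).union (hZ.image _)
  obtain ⟨t, htΩ, htB⟩ := (hB.dense_compl ℝ).inter_open_nonempty _ (hΩ.preimage hc) ⟨0, hc0⟩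
  have hre : (c t).re = 1 / 2 := by simp [c]
  have him : (c t).im = t := by simp [c]
  have j0 : JoinedIn (Ω \ Z) 0 (c t) := by
    refine JoinedIn.of_segment_subset fun z hz => ⟨hconv.segment_subset h0 htΩ hz, fun hzZ => ?_⟩
    obtain ⟨a, b, ha, hb, hab, rfl⟩ := hz
    have hb0 : b ≠ 0 := by
      rintro rfl
      exact hZ0 (by simpa using hzZ)
    refine htB (Or.inl ⟨_, hzZ, ?_⟩)
    simp [hre, him]
    field_simp
  have j1 : JoinedIn (Ω \ Z) (c t) 1 := by
    refine JoinedIn.of_segment_subset fun z hz => ⟨hconv.segment_subset htΩ h1 hz, fun hzZ => ?_⟩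
    obtain ⟨a, b, ha, hb, hab, rfl⟩ := hz
    obtain rfl : b = 1 - a := by linarith
    have ha0 : a ≠ 0 := by
      rintro rfl
      exact hZ1 (by simpa using hzZ)
    refine htB (Or.inr ⟨_, hzZ, ?_⟩)
    simp [hre, him]
    ring_nf
    field_simp
  exact j0.trans j1

/-- By the identity theorem the zeros are discrete, and a discrete subspace of the plane is
countable. -/
theorem countable_zeros {Ω : Set ℂ} (hΩ : IsOpen Ω) (hc : Convex ℝ Ω) {f : ℂ → ℂ}
    (hf : DifferentiableOn ℂ f Ω) {a : ℂ} (ha : a ∈ Ω) (hfa : f a ≠ 0) :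
    {z ∈ Ω | f z = 0}.Countable := by
  have han := hf.analyticOnNhd hΩ
  have hconn : _root_.IsConnected Ω := ⟨⟨a, ha⟩, hc.isPreconnected⟩
  have hmem := han.preimage_zero_mem_codiscreteWithin (x := a) hfa ha hconn
  have hd : IsDiscrete (f ⁻¹' {0} ∩ Ω) := by
    refine isDiscrete_of_codiscreteWithin (U := Ω) ?_ 
    exact hmem
  have : DiscreteTopology ↥(f ⁻¹' {0} ∩ Ω) := hd.to_subtype
  have : Countable ↥(f ⁻¹' {0} ∩ Ω) := TopologicalSpace.separableSpace_iff_countable.1 inferInstance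
  have hcount : (f ⁻¹' {0} ∩ Ω).Countable := Set.countable_coe_iff.1 this
  refine hcount.mono ?_
  rintro z ⟨h1, h2⟩
  exact ⟨h2, h1⟩

end Planar

/-! ### Connectedness and order of vanishing in a chart -/

section Parametrization

variable {A : Type*} [CommRing A] [Algebra ℂ A] {κ : Type*} [Fintype κ] {t : κ → A}
  {x : A →ₐ[ℂ] ℂ} {r : ℝ} {ψ : (κ → ℂ) → (A →ₐ[ℂ] ℂ)} (hψ : IsParametrization t x r ψ)
include hψ

theorem IsParametrization.continuousOn :
    ContinuousOn ψ (Metric.ball (fun i => x (t i)) r) :=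
  continuousOn_algPoint_iff.2 fun a => (hψ.differentiableOn a).continuousOn

/-- Two parameters are joined along the complex line through them, whose intersection with the ball
is convex and on which `f` has only countably many zeros. -/
theorem IsParametrization.isPathConnected {s : ℝ} (hs : s ≤ r) (S : Set A)
    (hne : (ψ '' Metric.ball (fun i => x (t i)) s ∩ {φ | ∃ f ∈ S, φ f ≠ 0}).Nonempty) :
    IsPathConnected (ψ '' Metric.ball (fun i => x (t i)) s ∩ {φ | ∃ f ∈ S, φ f ≠ 0}) := by
  set Q := Metric.ball (fun i => x (t i)) s with hQ
  have hQr : Q ⊆ Metric.ball (fun i => x (t i)) r := Metric.ball_subset_ball hs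
  obtain ⟨_, ⟨a, ha, rfl⟩, f, hf, hfa⟩ := hne
  refine ⟨ψ a, ⟨⟨a, ha, rfl⟩, f, hf, hfa⟩, ?_⟩
  rintro _ ⟨⟨b, hb, rfl⟩, g, hg, hgb⟩
  let ℓ : ℂ → (κ → ℂ) := fun τ => a + τ • (b - a)
  have hℓ : Differentiable ℂ ℓ := by fun_prop
  have hℓ0 : ℓ 0 = a := by simp [ℓ]
  have hℓ1 : ℓ 1 = b := by simp [ℓ]
  set Ω : Set ℂ := ℓ ⁻¹' Q with hΩdef
  have hΩ : IsOpen Ω := Metric.isOpen_ball.preimage hℓ.continuous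
  have hconv : Convex ℝ Ω := by
    intro τ hτ τ' hτ' u u' hu hu' huu
    have := convex_ball (fun i => x (t i)) s hτ hτ' hu hu' huu
    have he : ℓ (u • τ + u' • τ') = u • ℓ τ + u' • ℓ τ' := by
      have ha : a = u • a + u' • a := by rw [← add_smul, huu, one_smul]
      simp only [ℓ, smul_add, add_smul, smul_assoc]
      nth_rewrite 1 [ha]
      abel
    rw [hΩdef, Set.mem_preimage, he]
    exact this
  have h0 : (0 : ℂ) ∈ Ω := by rw [hΩdef, Set.mem_preimage, hℓ0]; exact ha
  have h1 : (1 : ℂ) ∈ Ω := by rw [hΩdef, Set.mem_preimage, hℓ1]; exact hb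
  have hF : DifferentiableOn ℂ (fun τ => ψ (ℓ τ) f) Ω :=
    (hψ.differentiableOn f).comp hℓ.differentiableOn fun τ hτ => hQr hτ
  have hZ := countable_zeros hΩ hconv hF h0 (by simpa only [hℓ0] using hfa)
  -- Only common zeros of `f` and `g` are removed: `f` is nonzero at one end and `g` at the other,
  -- and along the path one of them is nonzero.
  have hj := joinedIn_diff_countable (Z := {τ ∈ Ω | ψ (ℓ τ) f = 0} ∩ {τ | ψ (ℓ τ) g = 0}) hΩ hconv
    h0 h1 (hZ.mono Set.inter_subset_left) (fun h => hfa (by simpa only [hℓ0] using h.1.2))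
    (fun h => hgb (by
      have h2 : ψ (ℓ 1) g = 0 := h.2
      rwa [hℓ1] at h2))
  obtain ⟨γ, hγ⟩ := hj
  have hcont : ContinuousOn (ψ ∘ ℓ) Ω :=
    hψ.continuousOn.comp hℓ.continuous.continuousOn fun τ hτ => hQr hτ
  refine ⟨⟨⟨fun u => ψ (ℓ (γ u)), hcont.comp_continuous γ.continuous fun u => (hγ u).1⟩, ?_, ?_⟩,
    fun u => ⟨⟨_, (hγ u).1, rfl⟩, ?_⟩⟩
  · simp [hℓ0]
  · simp [hℓ1]
  · by_cases h : ψ (ℓ (γ u)) f = 0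
    · exact ⟨g, hg, fun h' => (hγ u).2 ⟨⟨(hγ u).1, h⟩, h'⟩⟩
    · exact ⟨f, hf, h⟩

/-- Along complex lines through the center, an element of the `k`-th power of the maximal ideal
vanishes to order `k`. -/
theorem IsParametrization.isBigO {k : ℕ} {g : A} (hg : g ∈ RingHom.ker x ^ k) (w : κ → ℂ) :
    (fun τ : ℂ => ψ ((fun i => x (t i)) + τ • w) g) =O[𝓝 0] fun τ : ℂ => τ ^ k := by
  have h1 : ∀ a ∈ RingHom.ker x, (fun τ : ℂ => ψ ((fun i => x (t i)) + τ • w) a) =O[𝓝 0]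
      fun τ : ℂ => τ := by
    intro a ha
    have hd : DifferentiableAt ℂ (fun τ : ℂ => ψ ((fun i => x (t i)) + τ • w) a) 0 := by
      have h2 : DifferentiableAt ℂ (fun z => ψ z a) ((fun i => x (t i)) + (0 : ℂ) • w) := by
        refine (hψ.differentiableOn a).differentiableAt (Metric.isOpen_ball.mem_nhds ?_)
        simpa using hψ.pos
      exact h2.comp (f := fun τ : ℂ => (fun i => x (t i)) + τ • w) (0 : ℂ) (by fun_prop)
    have := hd.isBigO_sub
    have hx : x a = 0 := ha
    simpa [hψ.center, hx] using this
  have hcont : ∀ a : A, (fun τ : ℂ => ψ ((fun i => x (t i)) + τ • w) a) =O[𝓝 0]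
      fun _ => (1 : ℂ) := by
    intro a
    have hc : ContinuousAt (fun τ : ℂ => ψ ((fun i => x (t i)) + τ • w) a) 0 := by
      have h2 : ContinuousAt (fun z => ψ z a) ((fun i => x (t i)) + (0 : ℂ) • w) := by
        refine (hψ.differentiableOn a).continuousOn.continuousAt (Metric.isOpen_ball.mem_nhds ?_)
        simpa using hψ.pos
      exact h2.comp (f := fun τ : ℂ => (fun i => x (t i)) + τ • w) (by fun_prop)
    exact hc.isBigO_one ℂ
  induction k generalizing g with
  | zero => simpa using hcont g
  | succ k ih =>
    rw [pow_succ] at hg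
    refine Submodule.mul_induction_on hg (fun a ha b hb => ?_) fun a b ha hb => ?_
    · simp only [map_mul, pow_succ]
      exact (ih ha).mul (h1 b hb)
    · simp only [map_add]
      exact ha.add hb

end Parametrization

/-! ### From Zariski density to analytic density -/

section Density

open MvPolynomial

variable {A : Type*} [CommRing A] [Algebra ℂ A]

theorem sub_algebraMap_mem_ker (x : A →ₐ[ℂ] ℂ) (a : A) : a - algebraMap ℂ A (x a) ∈ RingHom.ker x := by
  simp [RingHom.mem_ker]

/-- First order Taylor expansion modulo the square of a maximal ideal. -/
theorem taylor_mem_sq {ι : Type*} [Fintype ι] (x : A →ₐ[ℂ] ℂ) (v : ι → A) (q : MvPolynomial ι ℂ) :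
    aeval v q - algebraMap ℂ A (x (aeval v q)) -
      ∑ i, algebraMap ℂ A (x (aeval v (pderiv i q))) * (v i - algebraMap ℂ A (x (v i))) ∈
        RingHom.ker x ^ 2 := by
  classical
  induction q using MvPolynomial.induction_on with
  | C a => simp
  | add q r hq hr =>
    convert add_mem hq hr using 1
    simp only [map_add, add_mul, Finset.sum_add_distrib]
    ring
  | mul_X q j hq =>
    set c : A → A := fun a => algebraMap ℂ A (x a) with hc
    have hsum : ∑ i, c (aeval v (pderiv i (q * X j))) * (v i - c (v i)) =
        c (v j) * ∑ i, c (aeval v (pderiv i q)) * (v i - c (v i)) +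
          c (aeval v q) * (v j - c (v j)) := by
      simp only [pderiv_mul, pderiv_X, map_add, map_mul, aeval_X, hc, add_mul,
        Finset.sum_add_distrib, Finset.mul_sum]
      congr 1
      · exact Finset.sum_congr rfl fun i _ => by ring
      · rw [Finset.sum_eq_single j]
        · simp
        · intro i _ hij
          simp [hij.symm]
        · simp
    have hmul : c (aeval v (q * X j)) = c (aeval v q) * c (v j) := by simp [hc]
    have h1 : (aeval v q - c (aeval v q)) * (v j - c (v j)) ∈ RingHom.ker x ^ 2 := by
      rw [pow_two]
      exact Ideal.mul_mem_mul (sub_algebraMap_mem_ker x _) (sub_algebraMap_mem_ker x _)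
    convert add_mem (Ideal.mul_mem_left _ (c (v j)) hq) h1 using 1
    change _ - c (aeval v (q * X j)) - ∑ i, c (aeval v (pderiv i (q * X j))) * (v i - c (v i)) = _
    rw [hsum, hmul, map_mul, aeval_X]
    change _ = c (v j) * (_ - c (aeval v q) - ∑ i, c (aeval v (pderiv i q)) * (v i - c (v i))) + _
    ring

theorem ker_le_span_val {ι σ : Type*} [Finite σ] (P : Algebra.SubmersivePresentation ℂ A ι σ)
    (x : A →ₐ[ℂ] ℂ) :
    RingHom.ker x ≤ Ideal.span (Set.range fun i => P.val i - algebraMap ℂ A (x (P.val i))) := by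
  set I := Ideal.span (Set.range fun i => P.val i - algebraMap ℂ A (x (P.val i))) with hI
  have key : ∀ q : MvPolynomial ι ℂ, aeval P.val q - algebraMap ℂ A (x (aeval P.val q)) ∈ I := by
    intro q
    induction q using MvPolynomial.induction_on with
    | C a => simp
    | add q r hq hr =>
      convert add_mem hq hr using 1
      simp only [map_add]
      ring
    | mul_X q j hq =>
      convert add_mem (I.mul_mem_right (P.val j) hq)
        (I.mul_mem_left (algebraMap ℂ A (x (aeval P.val q))) (Ideal.subset_span ⟨j, rfl⟩)) using 1
      simp only [map_mul, aeval_X]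
      ring
  intro a ha
  obtain ⟨q, rfl⟩ := P.aeval_val_surjective a
  have := key q
  rwa [RingHom.mem_ker.1 ha, map_zero, sub_zero] at this

/-- The free coordinates generate the cotangent space. -/
theorem ker_le_span_sup_sq {ι σ : Type*} [Finite σ] [Finite ι]
    (P : Algebra.SubmersivePresentation ℂ A ι σ) (x : A →ₐ[ℂ] ℂ) :
    RingHom.ker x ≤ Ideal.span (Set.range fun i : FreeIndex P =>
      P.val i - algebraMap ℂ A (x (P.val i))) ⊔ RingHom.ker x ^ 2 := by
  classical
  have := Fintype.ofFinite ι
  have := Fintype.ofFinite σ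
  set I := Ideal.span (Set.range fun i : FreeIndex P =>
      P.val i - algebraMap ℂ A (x (P.val i))) ⊔ RingHom.ker x ^ 2 with hI
  let T : ι → A := fun i => P.val i - algebraMap ℂ A (x (P.val i))
  have hfree : ∀ i ∉ Set.range P.map, T i ∈ I := fun i hi =>
    Ideal.mem_sup_left (Ideal.subset_span ⟨⟨i, hi⟩, rfl⟩)
  have hrel : ∀ j, ∑ k, algebraMap ℂ A (x (aeval P.val (pderiv (P.map k) (P.relation j)))) *
      T (P.map k) ∈ I := by
    intro j
    have h1 := taylor_mem_sq x P.val (P.relation j)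
    rw [P.aeval_val_relation, map_zero, map_zero, sub_zero, zero_sub, neg_mem_iff] at h1
    have h2 : ∑ i, algebraMap ℂ A (x (aeval P.val (pderiv i (P.relation j)))) * T i ∈ I :=
      Ideal.mem_sup_right h1
    rw [← Finset.sum_add_sum_compl (Finset.univ.image P.map),
      Finset.sum_image P.map_inj.injOn] at h2
    refine (I.add_mem_iff_left (sum_mem fun i hi => I.mul_mem_left _ (hfree i ?_))).1 h2
    simpa using hi
  let M : Matrix σ σ ℂ := (x.toRingHom.comp (aeval P.val : _ →ₐ[ℂ] A).toRingHom).mapMatrix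
    P.jacobiMatrix
  have hM : IsUnit M.det := by
    have h := P.jacobian_isUnit.map x
    rw [P.jacobian_eq_jacobiMatrix_det, P.algebraMap_eq] at h
    have hdet : M.det = x (aeval P.val P.jacobiMatrix.det) := (RingHom.map_det _ _).symm
    rw [hdet]
    exact h
  have hMk : ∀ j k, M k j = x (aeval P.val (pderiv (P.map k) (P.relation j))) := fun j k => by
    change x (aeval P.val (P.jacobiMatrix k j)) = _
    rw [P.jacobiMatrix_apply]
  have hmap : ∀ l, T (P.map l) ∈ I := by
    intro l
    -- Modulo the ideal `I`, the relations are a linear system for the dependent coordinates with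
    -- invertible matrix `M`; multiplying by the inverse solves it.
    have hinv : M * M⁻¹ = 1 := Matrix.mul_nonsing_inv M hM
    have : T (P.map l) = ∑ j, algebraMap ℂ A (M⁻¹ j l) * ∑ k, algebraMap ℂ A (M k j) * T (P.map k) := by
      simp only [Finset.mul_sum]
      rw [Finset.sum_comm]
      have h3 : ∀ k, ∑ j, algebraMap ℂ A (M⁻¹ j l) * (algebraMap ℂ A (M k j) * T (P.map k)) =
          algebraMap ℂ A ((1 : Matrix σ σ ℂ) k l) * T (P.map k) := by
        intro k
        rw [← hinv, Matrix.mul_apply, map_sum, Finset.sum_mul]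
        refine Finset.sum_congr rfl fun j _ => ?_
        rw [map_mul]
        ring
      simp only [h3, Matrix.one_apply]
      simp [Finset.sum_ite_eq']
    rw [this]
    refine sum_mem fun j _ => I.mul_mem_left _ ?_
    simp only [hMk]
    exact hrel j
  refine (ker_le_span_val P x).trans (Ideal.span_le.2 ?_)
  rintro _ ⟨i, rfl⟩
  by_cases hi : i ∈ Set.range P.map
  · obtain ⟨l, rfl⟩ := hi
    exact hmap l
  · exact hfree i hi

omit [Algebra ℂ A] in
theorem ideal_pow_le_of_le_sup_sq {m T : Ideal A} (hT : T ≤ m) (h : m ≤ T ⊔ m ^ 2) (k : ℕ) :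
    m ^ k ≤ T ^ k ⊔ m ^ (k + 1) := by
  induction k with
  | zero => simp
  | succ k ih =>
    calc m ^ (k + 1) = m ^ k * m := pow_succ _ _
      _ ≤ (T ^ k ⊔ m ^ (k + 1)) * (T ⊔ m ^ 2) := Ideal.mul_mono ih h
      _ ≤ T ^ (k + 1) ⊔ m ^ (k + 1 + 1) := by
        rw [Ideal.sup_mul, Ideal.mul_sup, Ideal.mul_sup, ← pow_succ, ← pow_add]
        refine sup_le (sup_le le_sup_left ?_) (sup_le ?_ ?_)
        · refine le_sup_of_le_right ?_
          calc T ^ k * m ^ 2 ≤ m ^ k * m ^ 2 := Ideal.mul_mono_left (Ideal.pow_right_mono hT k)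
            _ = m ^ (k + 1 + 1) := by rw [← pow_add]
        · refine le_sup_of_le_right ?_
          calc m ^ (k + 1) * T ≤ m ^ (k + 1) * m := Ideal.mul_mono_right hT
            _ = m ^ (k + 1 + 1) := (pow_succ _ _).symm
        · exact le_sup_of_le_right (Ideal.pow_le_pow_right (by omega))

theorem eval_smul_of_isHomogeneous {κ : Type*} [Fintype κ] {q : MvPolynomial κ ℂ} {k : ℕ}
    (hq : q.IsHomogeneous k) (τ : ℂ) (w : κ → ℂ) : eval (τ • w) q = τ ^ k * eval w q := by
  rw [eval_eq', eval_eq', Finset.mul_sum]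
  refine Finset.sum_congr rfl fun d hd => ?_
  have hdeg : ∑ i, d i = k := by
    rw [← hq (mem_support_iff.1 hd), Finsupp.weight_apply, Finsupp.sum_fintype _ _ (by simp)]
    simp
  simp only [Pi.smul_apply, smul_eq_mul, mul_pow, Finset.prod_mul_distrib, Finset.prod_pow_eq_pow_sum,
    hdeg]
  ring

variable {κ : Type*} [Fintype κ] {t : κ → A}
  {x : A →ₐ[ℂ] ℂ} {r : ℝ} {ψ : (κ → ℂ) → (A →ₐ[ℂ] ℂ)} (hψ : IsParametrization t x r ψ)
include hψ

/-- Modulo the next power, `f` is a form `q` of degree `k` in the centered coordinates. On a line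
`z₀ + τ • w` the form contributes `τ ^ k` times its value at `w` and the remainder is `O(τ ^ (k +
1))`. As `f` vanishes, dividing by `τ ^ k` and letting `τ → 0` shows that `q` reduces to zero at
`x`, so its coefficients supply one more factor from the maximal ideal. -/
theorem IsParametrization.mem_pow_succ
    (hm : RingHom.ker x ≤ Ideal.span (Set.range fun i => t i - algebraMap ℂ A (x (t i))) ⊔
      RingHom.ker x ^ 2) {f : A} (hf : ∀ᶠ z in 𝓝 (fun i => x (t i)), ψ z f = 0) {k : ℕ}
    (hfk : f ∈ RingHom.ker x ^ k) : f ∈ RingHom.ker x ^ (k + 1) := by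
  set T : κ → A := fun i => t i - algebraMap ℂ A (x (t i)) with hTdef
  have hTm : ∀ i, T i ∈ RingHom.ker x := fun i => sub_algebraMap_mem_ker x _
  obtain ⟨p, hp, g, hg, rfl⟩ := Submodule.mem_sup.1 (ideal_pow_le_of_le_sup_sq
    (Ideal.span_le.2 (by rintro _ ⟨i, rfl⟩; exact hTm i)) hm k hfk)
  obtain ⟨q, hq, rfl⟩ := (Ideal.mem_span_pow_iff_exists_isHomogeneous _ _).1 hp
  refine add_mem ?_ hg
  set z₀ : κ → ℂ := fun i => x (t i) with hz₀
  have hline : ∀ w : κ → ℂ, Filter.Tendsto (fun τ : ℂ => z₀ + τ • w) (𝓝 0) (𝓝 z₀) := by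
    intro w
    have : Continuous fun τ : ℂ => z₀ + τ • w := by fun_prop
    simpa using this.tendsto 0
  have hval : ∀ (w : κ → ℂ), ∀ᶠ τ : ℂ in 𝓝 0, ψ (z₀ + τ • w) (eval T q) =
      τ ^ k * eval w (map (ψ (z₀ + τ • w) : A →+* ℂ) q) := by
    intro w
    filter_upwards [(hline w).eventually (Metric.ball_mem_nhds _ hψ.pos)] with τ hτ
    have h1 : ψ (z₀ + τ • w) (eval T q) = eval (τ • w) (map (ψ (z₀ + τ • w) : A →+* ℂ) q) := by
      rw [show ψ (z₀ + τ • w) (eval T q) = (ψ (z₀ + τ • w) : A →+* ℂ) (eval T q) from rfl,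
        ← eval₂_id, hom_eval₂, RingHomCompTriple.comp_eq, MvPolynomial.eval_map]
      congr 1
      ext i
      change ψ (z₀ + τ • w) (t i - algebraMap ℂ A (x (t i))) = τ * w i
      rw [map_sub, hψ.coord _ hτ, AlgHom.commutes]
      simp [hz₀]
    rw [h1]
    exact eval_smul_of_isHomogeneous (hq.map _) τ w
  have hcont : ∀ w : κ → ℂ, Filter.Tendsto
      (fun τ : ℂ => eval w (map (ψ (z₀ + τ • w) : A →+* ℂ) q)) (𝓝 0)
      (𝓝 (eval w (map (x : A →+* ℂ) q))) := by
    intro w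
    simp only [MvPolynomial.eval_map, eval₂_eq']
    refine tendsto_finsetSum _ fun d _ => Filter.Tendsto.mul_const _ ?_
    have h2 : ContinuousAt (fun z => ψ z (coeff d q)) z₀ :=
      (hψ.differentiableOn _).continuousOn.continuousAt (Metric.ball_mem_nhds _ hψ.pos)
    have h3 := h2.tendsto.comp (hline w)
    rw [hψ.center] at h3
    exact h3
  have hzero : map (x : A →+* ℂ) q = 0 := by
    refine (hq.map _).eq_zero_of_forall_eval_eq_zero fun w => ?_
    have hO := hψ.isBigO hg w
    have heq : ∀ᶠ τ : ℂ in 𝓝 0, ψ (z₀ + τ • w) g =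
        -(τ ^ k * eval w (map (ψ (z₀ + τ • w) : A →+* ℂ) q)) := by
      filter_upwards [hval w, (hline w).eventually hf] with τ h1 h2
      rw [map_add, h1] at h2
      exact eq_neg_of_add_eq_zero_right h2
    have hO' : (fun τ : ℂ => τ ^ k * eval w (map (ψ (z₀ + τ • w) : A →+* ℂ) q)) =O[𝓝[≠] 0]
        fun τ => τ ^ k * τ := by
      refine Asymptotics.IsBigO.mono ?_ nhdsWithin_le_nhds
      refine (hO.neg_left.congr' (heq.mono fun τ h => ?_) (.of_forall fun τ => pow_succ τ k))
      change -(ψ (z₀ + τ • w)) g = _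
      rw [h, neg_neg]
    have hO'' : (fun τ : ℂ => eval w (map (ψ (z₀ + τ • w) : A →+* ℂ) q)) =O[𝓝[≠] 0]
        fun τ => τ := by
      obtain ⟨C, hC⟩ := hO'.bound
      refine Asymptotics.IsBigO.of_bound C ?_
      filter_upwards [hC, self_mem_nhdsWithin] with τ h1 h2
      have h3 : 0 < ‖τ ^ k‖ := norm_pos_iff.2 (pow_ne_zero _ h2)
      rw [norm_mul, norm_mul, mul_left_comm] at h1
      exact le_of_mul_le_mul_left h1 h3
    exact tendsto_nhds_unique ((hcont w).mono_left nhdsWithin_le_nhds)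
      (hO''.trans_tendsto (Filter.tendsto_id.mono_left nhdsWithin_le_nhds))
  rw [eval_eq']
  refine sum_mem fun d hd => ?_
  have hdeg : ∑ i, d i = k := by
    rw [← hq (mem_support_iff.1 hd), Finsupp.weight_apply, Finsupp.sum_fintype _ _ (by simp)]
    simp
  rw [pow_succ']
  refine Ideal.mul_mem_mul ?_ ?_
  · have := congrArg (coeff d) hzero
    rwa [coeff_map, coeff_zero] at this
  · rw [← hdeg, ← Finset.prod_pow_eq_pow_sum]
    exact Ideal.prod_mem_prod fun i _ => Ideal.pow_mem_pow (hTm i) _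

-- Krull's intersection theorem gives `r * f = f` with `r` in the maximal ideal, so `1 - r` kills
-- `f` and has value `1` at `x`. The product over finitely many generators of `K` kills all of `K`.
omit hψ in
theorem exists_mul_eq_zero_of_forall_mem_pow [IsNoetherianRing A] (x : A →ₐ[ℂ] ℂ) {K : Ideal A}
    (hK : ∀ f ∈ K, ∀ k, f ∈ RingHom.ker x ^ k) : ∃ u : A, x u ≠ 0 ∧ ∀ f ∈ K, u * f = 0 := by
  classical
  have h1 : ∀ f ∈ K, ∃ u : A, x u = 1 ∧ u * f = 0 := by
    intro f hf
    obtain ⟨⟨r, hr⟩, hrf⟩ := ((RingHom.ker x).mem_iInf_smul_pow_eq_bot_iff f).1 (by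
      simpa [Submodule.mem_iInf] using hK f hf)
    refine ⟨1 - r, by simp [RingHom.mem_ker.1 hr], ?_⟩
    have hrf' : r * f = f := hrf
    rw [sub_mul, hrf', one_mul, sub_self]
  obtain ⟨s, hs⟩ := (isNoetherianRing_iff_ideal_fg A).1 inferInstance K
  choose! u hu using h1
  have hsK : ∀ f ∈ s, f ∈ K := fun f hf => hs ▸ Ideal.subset_span hf
  refine ⟨∏ f ∈ s, u f, ?_, fun f hf => ?_⟩
  · rw [map_prod, Finset.prod_congr rfl fun f hf => (hu f (hsK f hf)).1]
    simp
  · rw [← hs] at hf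
    induction hf using Submodule.span_induction with
    | mem f hf =>
      rw [← Finset.prod_erase_mul _ _ hf, mul_assoc, (hu f (hsK f hf)).2, mul_zero]
    | zero => exact mul_zero _
    | add a b _ _ ha hb => rw [mul_add, ha, hb, add_zero]
    | smul a b _ hb => rw [smul_eq_mul, mul_left_comm, hb, mul_zero]

/-- If the functions in `S` vanish near `x`, they are annihilated by a function which does not
vanish at `x`. -/
theorem IsParametrization.exists_mul_eq_zero [IsNoetherianRing A]
    (hm : RingHom.ker x ≤ Ideal.span (Set.range fun i => t i - algebraMap ℂ A (x (t i))) ⊔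
      RingHom.ker x ^ 2) {s : ℝ} (hs : 0 < s) {S : Set A}
    (hS : ∀ f ∈ S, ∀ φ ∈ ψ '' Metric.ball (fun i => x (t i)) s, φ f = 0) :
    ∃ u : A, x u ≠ 0 ∧ ∀ f ∈ S, u * f = 0 := by
  -- All functions vanishing on the chart image form an ideal, finitely generated even when `S` is
  -- infinite.
  let K : Ideal A := ⨅ φ ∈ ψ '' Metric.ball (fun i => x (t i)) s, RingHom.ker φ
  have hK : ∀ f, f ∈ K ↔ ∀ φ ∈ ψ '' Metric.ball (fun i => x (t i)) s, φ f = 0 := fun f => by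
    simp only [K, Submodule.mem_iInf, RingHom.mem_ker]
  obtain ⟨u, hu, h⟩ := exists_mul_eq_zero_of_forall_mem_pow x (K := K) fun f hf k => by
    induction k with
    | zero => simp
    | succ k ih =>
      refine hψ.mem_pow_succ hm ?_ ih
      filter_upwards [Metric.ball_mem_nhds _ hs] with z hz
      exact (hK f).1 hf _ ⟨z, hz, rfl⟩
  exact ⟨u, hu, fun f hf => h f ((hK f).2 (hS f hf))⟩

omit [Fintype κ] hψ in
/-- For a standard smooth algebra the complement of a nowhere dense closed subset meets small
neighborhoods in nonempty path connected sets. -/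
theorem exists_isPathConnected_inter [Algebra.IsStandardSmooth ℂ A] (x : A →ₐ[ℂ] ℂ)
    {O : Set (A →ₐ[ℂ] ℂ)} (hO : IsOpen O) (hx : x ∈ O) (S : Set A)
    (hS : ∀ u : A, x u ≠ 0 → ∃ f ∈ S, u * f ≠ 0) :
    ∃ N : Set (A →ₐ[ℂ] ℂ), IsOpen N ∧ x ∈ N ∧ N ⊆ O ∧
      IsPathConnected (N ∩ {φ | ∃ f ∈ S, φ f ≠ 0}) := by
  obtain ⟨ι, σ, _, _, ⟨P⟩⟩ := Algebra.IsStandardSmooth.out (R := ℂ) (S := A)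
  have := Fintype.ofFinite ι
  have hft : Algebra.FiniteType ℂ A := inferInstance
  have : IsNoetherianRing A := Algebra.FiniteType.isNoetherianRing ℂ A
  obtain ⟨r, ψ, hψ⟩ := exists_isParametrization P x
  have hcont : ContinuousAt ψ (fun i => x (P.val i)) :=
    hψ.continuousOn.continuousAt (Metric.ball_mem_nhds _ hψ.pos)
  obtain ⟨s, hs, hsO⟩ := Metric.eventually_nhds_iff_ball.1
    (hcont.eventually (hO.mem_nhds (by rw [hψ.center]; exact hx)))
  refine ⟨ψ '' Metric.ball (fun i => x (P.val i)) (min r s), hψ.isOpen_image _ (min_le_left _ _),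
    ⟨_, Metric.mem_ball_self (lt_min hψ.pos hs), hψ.center⟩, ?_,
    hψ.isPathConnected (min_le_left _ _) S ?_⟩
  · rintro _ ⟨z, hz, rfl⟩
    exact hsO z (Metric.ball_subset_ball (min_le_right _ _) hz)
  · by_contra hne
    obtain ⟨u, hu, h⟩ := hψ.exists_mul_eq_zero (ker_le_span_sup_sq P x) (lt_min hψ.pos hs)
      (S := S) fun f hf φ hφ => by
        by_contra h0
        exact hne ⟨φ, hφ, f, hf, h0⟩
    obtain ⟨f, hf, hne'⟩ := hS u hu
    exact hne' (h f hf)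

end Density

/-! ### Complex points of a ring of invariants -/

section Invariants

variable {G A B : Type*} [Group G] [CommRing A] [Algebra ℂ A] [CommRing B] [Algebra ℂ B]

/-- `j` identifies `B` with the ring of invariants of a right action `α` on `A`. -/
structure IsInvariantRing (α : G → A →ₐ[ℂ] A) (j : B →ₐ[ℂ] A) : Prop where
  one : α 1 = AlgHom.id ℂ A
  mul : ∀ g h, α (g * h) = (α h).comp (α g)
  injective : Function.Injective j
  mem_range_iff : ∀ a, a ∈ Set.range j ↔ ∀ g, α g a = a

variable {α : G → A →ₐ[ℂ] A} {j : B →ₐ[ℂ] A} (hj : IsInvariantRing α j) [Finite G]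
include hj

/-- The left action attached to the right action. -/
abbrev IsInvariantRing.mulSemiringAction : MulSemiringAction G A where
  smul g a := α g⁻¹ a
  one_smul a := by change α 1⁻¹ a = a; rw [inv_one, hj.one]; rfl
  mul_smul g h a := by change α (g * h)⁻¹ a = α g⁻¹ (α h⁻¹ a); rw [mul_inv_rev, hj.mul]; rfl
  smul_zero g := map_zero _
  smul_add g := map_add _
  smul_one g := map_one _
  smul_mul g := map_mul _

omit [Finite G] in
theorem IsInvariantRing.isInvariant :
    letI := j.toRingHom.toAlgebra
    letI := hj.mulSemiringAction
    Algebra.IsInvariant B A G := by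
  let := j.toRingHom.toAlgebra
  let := hj.mulSemiringAction
  refine ⟨fun a ha => ?_⟩
  exact (hj.mem_range_iff a).2 fun g => by
    have := ha g⁻¹
    change α g⁻¹⁻¹ a = a at this
    rwa [inv_inv] at this

theorem IsInvariantRing.isIntegral : j.toRingHom.IsIntegral := by
  let := j.toRingHom.toAlgebra
  let := hj.mulSemiringAction
  have := hj.isInvariant
  have := Algebra.IsInvariant.isIntegral B A G
  exact fun a => this.isIntegral a

omit [Finite G] hj in
theorem algPoint_ext_of_ker_le {φ ψ : A →ₐ[ℂ] ℂ} (h : ∀ a, ψ a = 0 → φ a = 0) : φ = ψ := by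
  ext a
  have := h (a - algebraMap ℂ A (ψ a)) (by simp)
  rw [map_sub, AlgHom.commutes, sub_eq_zero] at this
  exact this

open scoped Pointwise in
/-- The fibers of the restriction map on complex points are orbits. -/
theorem IsInvariantRing.exists_comp_eq {φ ψ : A →ₐ[ℂ] ℂ} (h : φ.comp j = ψ.comp j) :
    ∃ g, φ.comp (α g) = ψ := by
  let := j.toRingHom.toAlgebra
  let := hj.mulSemiringAction
  have := hj.isInvariant
  have : SMulCommClass G B A := ⟨fun g b a => by
    change α g⁻¹ (j b * a) = j b * α g⁻¹ a
    rw [map_mul, (hj.mem_range_iff (j b)).1 ⟨b, rfl⟩]⟩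
  have : (RingHom.ker φ).IsPrime := RingHom.ker_isPrime φ
  have : (RingHom.ker ψ).IsPrime := RingHom.ker_isPrime ψ
  -- The group is transitive on primes over a given prime, and a complex point is determined by its
  -- kernel.
  obtain ⟨g, hg⟩ := Algebra.IsInvariant.exists_smul_of_under_eq B A G (RingHom.ker φ)
    (RingHom.ker ψ) (Ideal.ext fun b => by
      change φ (j b) = 0 ↔ ψ (j b) = 0
      rw [show φ (j b) = ψ (j b) from DFunLike.congr_fun h b])
  refine ⟨g, algPoint_ext_of_ker_le fun a ha => ?_⟩
  have h1 : a ∈ g • RingHom.ker φ := by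
    rw [← hg]
    exact ha
  rw [Ideal.mem_pointwise_smul_iff_inv_smul_mem] at h1
  have h2 : φ (α g⁻¹⁻¹ a) = 0 := h1
  rwa [inv_inv] at h2

/-- Complex points of the ring of invariants lift. -/
theorem IsInvariantRing.exists_lift (y : B →ₐ[ℂ] ℂ) : ∃ φ : A →ₐ[ℂ] ℂ, φ.comp j = y := by
  let := j.toRingHom.toAlgebra
  have : Algebra.IsIntegral B A := ⟨fun a => hj.isIntegral a⟩
  have hmap : ∀ b, algebraMap B A b = j b := fun _ => rfl
  have hy : Function.Surjective y := fun c => ⟨algebraMap ℂ B c, by simp⟩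
  have hmax : (RingHom.ker y).IsMaximal := RingHom.ker_isMaximal_of_surjective y hy
  obtain ⟨Q, hQ, hQy⟩ := Ideal.exists_ideal_over_maximal_of_isIntegral (S := A) (RingHom.ker y)
    (fun b hb => by
      have hb0 : j b = 0 := hb
      rw [(injective_iff_map_eq_zero j).1 hj.injective b hb0]; exact zero_mem _)
  have hmem : ∀ b, Ideal.Quotient.mk Q (j b) = algebraMap ℂ (A ⧸ Q) (y b) := by
    intro b
    have h1 : b - algebraMap ℂ B (y b) ∈ Q.comap (algebraMap B A) := by
      rw [hQy]; simp [RingHom.mem_ker]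
    have h2 : j (b - algebraMap ℂ B (y b)) ∈ Q := h1
    rw [map_sub, AlgHom.commutes] at h2
    exact (Ideal.Quotient.eq.2 h2).trans rfl
  -- Reducing integral equations over `B` at `y` makes the residue field of `Q` integral over `ℂ`,
  -- hence equal to `ℂ`.
  have hint : Algebra.IsIntegral ℂ (A ⧸ Q) := by
    refine ⟨fun a => ?_⟩
    obtain ⟨a, rfl⟩ := Ideal.Quotient.mk_surjective a
    obtain ⟨p, hp, hpa⟩ := hj.isIntegral a
    refine ⟨p.map (y : B →+* ℂ), hp.map _, ?_⟩
    have h3 := congrArg (Ideal.Quotient.mk Q) hpa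
    rw [map_zero, Polynomial.hom_eval₂] at h3
    rw [Polynomial.eval₂_map, ← h3]
    congr 1
    ext b
    exact (hmem b).symm
  have hdom : IsDomain (A ⧸ Q) := Ideal.Quotient.isDomain Q
  let e : ℂ ≃ₐ[ℂ] (A ⧸ Q) := AlgEquiv.ofBijective (Algebra.ofId ℂ (A ⧸ Q))
    (IsAlgClosed.algebraMap_bijective_of_isIntegral (k := ℂ) (K := A ⧸ Q))
  refine ⟨e.symm.toAlgHom.comp (Ideal.Quotient.mkₐ ℂ Q), ?_⟩
  ext b
  change e.symm (Ideal.Quotient.mk Q (j b)) = y b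
  rw [hmem, AlgEquiv.symm_apply_eq]
  rfl

/-- Elements of `A` are bounded along ultrafilters whose image in the points of `B` converges. -/
theorem IsInvariantRing.exists_tendsto (L : Ultrafilter (A →ₐ[ℂ] ℂ)) {y : B →ₐ[ℂ] ℂ}
    (hL : Filter.Tendsto (fun φ : A →ₐ[ℂ] ℂ => φ.comp j) L (𝓝 y)) (a : A) :
    ∃ c : ℂ, Filter.Tendsto (fun φ : A →ₐ[ℂ] ℂ => φ a) L (𝓝 c) := by
  obtain ⟨p, hp, hpa⟩ := hj.isIntegral a
  have hev : ∀ i ∈ Finset.range p.natDegree, ∀ᶠ φ : A →ₐ[ℂ] ℂ in L,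
      ‖φ (j (p.coeff i))‖ ≤ ‖y (p.coeff i)‖ + 1 := by
    intro i _
    have h1 : Filter.Tendsto (fun φ : A →ₐ[ℂ] ℂ => ‖φ (j (p.coeff i))‖) L (𝓝 ‖y (p.coeff i)‖) :=
      (tendsto_algPoint_iff.1 hL (p.coeff i)).norm
    exact h1.eventually (eventually_le_nhds (lt_add_one _))
  have hbound : ∀ᶠ φ : A →ₐ[ℂ] ℂ in L, φ a ∈ Metric.closedBall (0 : ℂ)
      (∑ i ∈ Finset.range p.natDegree, (‖y (p.coeff i)‖ + 1) + 1) := by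
    filter_upwards [(Finset.eventually_all _).2 hev] with φ hφ
    have hroot : (p.map ((φ.comp j : B →ₐ[ℂ] ℂ) : B →+* ℂ)).IsRoot (φ a) := by
      have h3 := congrArg φ hpa
      rw [map_zero] at h3
      change φ.toRingHom _ = 0 at h3
      rw [Polynomial.hom_eval₂] at h3
      rw [Polynomial.IsRoot.def, Polynomial.eval_map]
      exact h3
    have hmon : (p.map ((φ.comp j : B →ₐ[ℂ] ℂ) : B →+* ℂ)).Monic := hp.map _
    rw [mem_closedBall_zero_iff]
    -- Cauchy's bound for roots of the integral equation; its coefficients are eventually bounded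
    -- because their values converge.
    refine (NNReal.coe_le_coe.2 (hroot.norm_lt_cauchyBound hmon.ne_zero).le).trans ?_
    rw [Polynomial.cauchyBound, hmon.leadingCoeff, nnnorm_one, div_one, NNReal.coe_add, NNReal.coe_one]
    gcongr
    have hM : 0 ≤ ∑ i ∈ Finset.range p.natDegree, (‖y (p.coeff i)‖ + 1) :=
      Finset.sum_nonneg fun i _ => by positivity
    refine (NNReal.coe_le_coe.2 (Finset.sup_le fun i hi => ?_)).trans (Real.coe_toNNReal _ hM).le
    rw [hp.natDegree_map] at hi
    rw [Real.le_toNNReal_iff_coe_le hM]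
    calc _ = ‖φ (j (p.coeff i))‖ := by simp
      _ ≤ ‖y (p.coeff i)‖ + 1 := hφ i hi
      _ ≤ _ := Finset.single_le_sum (f := fun i => ‖y (p.coeff i)‖ + 1)
        (fun i _ => by positivity) hi
  have hcpt := (isCompact_closedBall (0 : ℂ)
    (∑ i ∈ Finset.range p.natDegree, (‖y (p.coeff i)‖ + 1) + 1)).ultrafilter_le_nhds
      (L.map fun φ : A →ₐ[ℂ] ℂ => φ a) (Filter.le_principal_iff.2 hbound)
  obtain ⟨c, -, hc⟩ := hcpt
  exact ⟨c, hc⟩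

/-- The restriction map on complex points is open. -/
theorem IsInvariantRing.isOpenMap : IsOpenMap fun φ : A →ₐ[ℂ] ℂ => φ.comp j := by
  intro O hO
  rw [isOpen_iff_ultrafilter]
  rintro _ ⟨φ₀, hφ₀, rfl⟩ l hl
  let res : (A →ₐ[ℂ] ℂ) → (B →ₐ[ℂ] ℂ) := fun φ => φ.comp j
  have hsurj : Function.Surjective res := hj.exists_lift
  have : (Filter.comap res (l : Filter (B →ₐ[ℂ] ℂ))).NeBot :=
    Filter.NeBot.comap_of_surj l.neBot hsurj
  -- Surjectivity on points lifts `l` to an ultrafilter `L` upstairs, whose pointwise limit is a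
  -- point over the same image as `φ₀`.
  let L := Ultrafilter.of (Filter.comap res (l : Filter (B →ₐ[ℂ] ℂ)))
  have hL : Filter.Tendsto res L l := Filter.tendsto_iff_comap.2 (Ultrafilter.of_le _)
  have hmapL : L.map res = l := Ultrafilter.coe_le_coe.1 hL
  choose lim hlim using fun a => hj.exists_tendsto L (hL.mono_right hl) a
  let φ : A →ₐ[ℂ] ℂ :=
    { toFun := lim
      map_one' := tendsto_nhds_unique (hlim 1) (by simp)
      map_mul' := fun a b => tendsto_nhds_unique (hlim (a * b)) (by
        simpa using (hlim a).mul (hlim b))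
      map_zero' := tendsto_nhds_unique (hlim 0) (by simp)
      map_add' := fun a b => tendsto_nhds_unique (hlim (a + b)) (by
        simpa using (hlim a).add (hlim b))
      commutes' := fun c => tendsto_nhds_unique (hlim _) (by simp) }
  have hφ : Filter.Tendsto id (L : Filter (A →ₐ[ℂ] ℂ)) (𝓝 φ) := tendsto_algPoint_iff.2 hlim
  have hres : φ.comp j = φ₀.comp j := by
    ext b
    exact tendsto_nhds_unique (hlim (j b))
      (tendsto_algPoint_iff.1 (hL.mono_right hl) b)
  obtain ⟨g, hg⟩ := hj.exists_comp_eq hres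
  have hcomp : Continuous fun ψ : A →ₐ[ℂ] ℂ => ψ.comp (α g) :=
    continuous_algPoint_iff.2 fun a => continuous_algPoint_apply (α g a)
  -- Translation by `g` makes `L` converge to `φ₀`, so it eventually enters `O`, while the image
  -- below is unchanged.
  have hev : ∀ᶠ ψ : A →ₐ[ℂ] ℂ in L, ψ.comp (α g) ∈ O :=
    ((hcomp.tendsto φ).comp hφ).eventually (hO.mem_nhds (by rw [hg]; exact hφ₀))
  rw [← hmapL]
  change ∀ᶠ ψ : A →ₐ[ℂ] ℂ in L, res ψ ∈ _
  filter_upwards [hev] with ψ hψ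
  refine ⟨_, hψ, ?_⟩
  ext b
  exact congrArg ψ ((hj.mem_range_iff (j b)).1 ⟨b, rfl⟩ g)

end Invariants

/-! ### Complex points of schemes and of algebras of sections -/

namespace ComplexPoint

variable {X Y : Over SpecC}

/-- The structure morphism of a scheme over `ℂ`. -/
def structureMorphism (X : Over SpecC) : X.left ⟶ SpecC := X.hom

theorem comp_structureMorphism (f : X ⟶ Y) :
    f.left ≫ structureMorphism Y = structureMorphism X := Over.w f

theorem le_preimage_top (f : X.left ⟶ SpecC) (V : X.left.Opens) : V ≤ f ⁻¹ᵁ ⊤ :=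
  fun _ _ => trivial

/-- The structure homomorphism of the ring of sections over an open subset. -/
def sectionsHom (X : Over SpecC) (V : X.left.Opens) : CommRingCat.of ℂ ⟶ Γ(X.left, V) :=
  (Scheme.ΓSpecIso (CommRingCat.of ℂ)).inv ≫ (structureMorphism X).appLE ⊤ V (le_preimage_top _ V)

instance algebraSections (X : Over SpecC) (V : X.left.Opens) : Algebra ℂ Γ(X.left, V) :=
  (sectionsHom X V).hom.toAlgebra

theorem sectionsHom_comp_appLE (f : X ⟶ Y) (V : Y.left.Opens) (W : X.left.Opens)
    (e : W ≤ f.left ⁻¹ᵁ V) :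
    sectionsHom Y V ≫ f.left.appLE V W e = sectionsHom X W := by
  unfold sectionsHom
  rw [Category.assoc, Scheme.Hom.appLE_comp_appLE]
  simp only [comp_structureMorphism]

/-- The pullback of sections, as a homomorphism of algebras. -/
def pullback (f : X ⟶ Y) (V : Y.left.Opens) (W : X.left.Opens) (e : W ≤ f.left ⁻¹ᵁ V) :
    Γ(Y.left, V) →ₐ[ℂ] Γ(X.left, W) :=
  { (f.left.appLE V W e).hom with
    commutes' := fun c => congrArg (fun h => h.hom c) (sectionsHom_comp_appLE f V W e) }

theorem pullback_apply (f : X ⟶ Y) (V : Y.left.Opens) (W : X.left.Opens) (e : W ≤ f.left ⁻¹ᵁ V)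
    (s : Γ(Y.left, V)) : pullback f V W e s = f.left.appLE V W e s := rfl

theorem morphism_comp_hom (x : ComplexPoint X) :
    x.morphism ≫ structureMorphism X = 𝟙 SpecC :=
  Over.w (show Over.mk (𝟙 SpecC) ⟶ X from x)

theorem sectionsHom_comp_eval (x : ComplexPoint X) {V : X.left.Opens} (h : x.pt ∈ V) :
    sectionsHom X V ≫ x.morphism.appLE V ⊤ (x.top_le h) ≫
      (Scheme.ΓSpecIso (CommRingCat.of ℂ)).hom = 𝟙 _ := by
  have h1 : (structureMorphism X).appLE ⊤ V (le_preimage_top _ V) ≫ x.morphism.appLE V ⊤ (x.top_le h) =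
      𝟙 _ := by
    rw [Scheme.Hom.appLE_comp_appLE]
    simp only [morphism_comp_hom]
    simp only [Scheme.Hom.appLE, Scheme.Hom.id_app]
    exact SpecC.presheaf.map_id _
  unfold sectionsHom
  rw [Category.assoc, reassoc_of% h1, Iso.inv_hom_id]

/-- Evaluation at a point, as a homomorphism of algebras. -/
def evalHom (x : ComplexPoint X) {V : X.left.Opens} (h : x.pt ∈ V) : Γ(X.left, V) →ₐ[ℂ] ℂ :=
  { (x.morphism.appLE V ⊤ (x.top_le h) ≫ (Scheme.ΓSpecIso (CommRingCat.of ℂ)).hom).hom with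
    commutes' := fun c => congrArg (fun h => h.hom c) (x.sectionsHom_comp_eval h) }

theorem evalHom_apply (x : ComplexPoint X) {V : X.left.Opens} (h : x.pt ∈ V) (f : Γ(X.left, V)) :
    x.evalHom h f = x.eval h f := rfl

theorem ext_morphism {x y : ComplexPoint X} (h : x.morphism = y.morphism) : x = y :=
  Over.OverMorphism.ext (f := (show Over.mk (𝟙 SpecC) ⟶ X from x)) h

theorem fromSpec_top_specC :
    (isAffineOpen_top SpecC).fromSpec = Spec.map (Scheme.ΓSpecIso (CommRingCat.of ℂ)).inv := by
  rw [IsAffineOpen.fromSpec_top, Scheme.isoSpec_Spec_inv]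

section Affine

variable {V : X.left.Opens} (hV : IsAffineOpen V)

/-- The point with given values of the regular functions on an affine open subset. -/
def ofAlgHom (φ : Γ(X.left, V) →ₐ[ℂ] ℂ) : ComplexPoint X :=
  Over.homMk (U := Over.mk (𝟙 SpecC)) (V := X)
    (Spec.map (CommRingCat.ofHom (φ : Γ(X.left, V) →+* ℂ)) ≫ hV.fromSpec) (by
      have h1 : hV.fromSpec ≫ structureMorphism X = Spec.map (sectionsHom X V) := by
        have := IsAffineOpen.SpecMap_appLE_fromSpec (structureMorphism X)
          (isAffineOpen_top SpecC) hV (le_preimage_top _ V)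
        rw [fromSpec_top_specC, ← Spec.map_comp] at this
        exact this.symm
      have h2 : sectionsHom X V ≫ CommRingCat.ofHom (φ : Γ(X.left, V) →+* ℂ) = 𝟙 _ := by
        ext c
        exact φ.commutes c
      change (Spec.map _ ≫ hV.fromSpec) ≫ structureMorphism X = 𝟙 SpecC
      rw [Category.assoc, h1, ← Spec.map_comp, h2, Spec.map_id])

theorem ofAlgHom_morphism (φ : Γ(X.left, V) →ₐ[ℂ] ℂ) :
    (ofAlgHom hV φ).morphism =
      Spec.map (CommRingCat.ofHom (φ : Γ(X.left, V) →+* ℂ)) ≫ hV.fromSpec := rfl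

theorem ofAlgHom_mem (φ : Γ(X.left, V) →ₐ[ℂ] ℂ) : (ofAlgHom hV φ).pt ∈ V := by
  have h : (ofAlgHom hV φ).pt ∈ Set.range hV.fromSpec := by
    exact ⟨Spec.map (CommRingCat.ofHom (φ : Γ(X.left, V) →+* ℂ)) (IsLocalRing.closedPoint ℂ), rfl⟩
  rwa [hV.range_fromSpec] at h

/-- Since `hV.fromSpec` is a monomorphism and `Spec` is faithful, the comparison reduces to ring
maps. -/
theorem evalHom_ofAlgHom (φ : Γ(X.left, V) →ₐ[ℂ] ℂ) :
    (ofAlgHom hV φ).evalHom (ofAlgHom_mem hV φ) = φ := by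
  have h1 := IsAffineOpen.SpecMap_appLE_fromSpec (ofAlgHom hV φ).morphism hV (isAffineOpen_top SpecC)
    ((ofAlgHom hV φ).top_le (ofAlgHom_mem hV φ))
  replace h1 := h1.trans (congrArg (_ ≫ ·) (ofAlgHom_morphism hV φ))
  rw [← Category.assoc, cancel_mono, fromSpec_top_specC, ← Spec.map_comp] at h1
  have h2 := Spec.map_injective h1
  ext f
  change (((ofAlgHom hV φ).morphism.appLE V ⊤ _) ≫ (Scheme.ΓSpecIso (CommRingCat.of ℂ)).hom) f = φ f
  rw [h2, Category.assoc, Iso.inv_hom_id, Category.comp_id]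
  rfl

theorem ofAlgHom_evalHom (x : ComplexPoint X) (h : x.pt ∈ V) : ofAlgHom hV (x.evalHom h) = x := by
  apply ext_morphism
  have h1 := IsAffineOpen.SpecMap_appLE_fromSpec x.morphism hV (isAffineOpen_top SpecC) (x.top_le h)
  rw [fromSpec_top_specC] at h1
  rw [ofAlgHom_morphism]
  change Spec.map (x.morphism.appLE V ⊤ (x.top_le h) ≫
    (Scheme.ΓSpecIso (CommRingCat.of ℂ)).hom) ≫ hV.fromSpec = _
  rw [Spec.map_comp, Category.assoc, h1, ← Category.assoc, ← Spec.map_comp, Iso.inv_hom_id,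
    Spec.map_id, Category.id_comp]

end Affine

theorem map_morphism (f : X ⟶ Y) (x : ComplexPoint X) : (x.map f).morphism = x.morphism ≫ f.left :=
  rfl

theorem eval_pullback (f : X ⟶ Y) (x : ComplexPoint X) {V : Y.left.Opens} {W : X.left.Opens}
    (e : W ≤ f.left ⁻¹ᵁ V) (h : x.pt ∈ W) (h' : (x.map f).pt ∈ V) (s : Γ(Y.left, V)) :
    (x.map f).eval h' s = x.eval h (pullback f V W e s) := by
  unfold eval
  rw [pullback_apply]
  simp only [map_morphism]
  rw [← Scheme.Hom.appLE_comp_appLE _ _ V W ⊤ e (x.top_le h)]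
  rfl

theorem eval_restrict (x : ComplexPoint X) {V W : X.left.Opens} (i : W ≤ V) (h : x.pt ∈ W)
    (s : Γ(X.left, V)) :
    x.eval h (X.left.presheaf.map (homOfLE i).op s) = x.eval (i h) s := by
  unfold eval
  rw [← Scheme.Hom.map_appLE _ (x.top_le h) (homOfLE i).op]
  rfl

theorem mem_basicOpen_iff (x : ComplexPoint X) {V : X.left.Opens} (h : x.pt ∈ V)
    (f : Γ(X.left, V)) : x.pt ∈ X.left.basicOpen f ↔ x.eval h f ≠ 0 := by
  have h1 := Scheme.basicOpen_appLE x.morphism ⊤ V (x.top_le h) f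
  rw [basicOpen_eq_of_affine', top_inf_eq] at h1
  have h2 : x.pt ∈ X.left.basicOpen f ↔ IsLocalRing.closedPoint ℂ ∈
    PrimeSpectrum.basicOpen (x.eval h f) := by
    change IsLocalRing.closedPoint ℂ ∈ x.morphism ⁻¹ᵁ (X.left.basicOpen f) ↔ _
    rw [← h1]
    rfl
  rw [h2, PrimeSpectrum.mem_basicOpen]
  change x.eval h f ∉ IsLocalRing.maximalIdeal ℂ ↔ _
  rw [IsLocalRing.maximalIdeal_eq_bot, Ideal.mem_bot]

/-! ### The analytic topology -/

theorem isOpen_setOf_eval {V : X.left.Opens} (f : Γ(X.left, V)) {O : Set ℂ} (hO : IsOpen O) :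
    IsOpen {x : ComplexPoint X | ∃ h : x.pt ∈ V, x.eval h f ∈ O} :=
  TopologicalSpace.isOpen_generateFrom_of_mem ⟨V, f, O, hO, rfl⟩

theorem isOpen_pointsIn (V : X.left.Opens) : IsOpen (pointsIn V) := by
  convert isOpen_setOf_eval (0 : Γ(X.left, V)) isOpen_univ using 1
  ext x
  simp [pointsIn]

theorem continuous_map (f : X ⟶ Y) : Continuous (map f) := by
  refine continuous_generateFrom_iff.2 ?_
  rintro _ ⟨V, s, O, hO, rfl⟩
  convert isOpen_setOf_eval (pullback f V (f.left ⁻¹ᵁ V) le_rfl s) hO using 1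
  ext x
  constructor
  · rintro ⟨h, hs⟩
    exact ⟨h, by rwa [← eval_pullback f x le_rfl h h]⟩
  · rintro ⟨h, hs⟩
    exact ⟨h, by rwa [eval_pullback f x le_rfl h h]⟩

section Affine

variable {V : X.left.Opens} (hV : IsAffineOpen V)

theorem ofAlgHom_eval (φ : Γ(X.left, V) →ₐ[ℂ] ℂ) (f : Γ(X.left, V)) :
    (ofAlgHom hV φ).eval (ofAlgHom_mem hV φ) f = φ f := by
  rw [← evalHom_apply, evalHom_ofAlgHom]

theorem ofAlgHom_mem_basicOpen_iff (φ : Γ(X.left, V) →ₐ[ℂ] ℂ) (f : Γ(X.left, V)) :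
    (ofAlgHom hV φ).pt ∈ X.left.basicOpen f ↔ φ f ≠ 0 := by
  rw [mem_basicOpen_iff _ (ofAlgHom_mem hV φ), ofAlgHom_eval]

/-- The analytic topology tests functions on every open `W`, not just on `V`. Near a point, such a
function is a fraction `a / g ^ n` of functions on `V`, continuous where `g` is nonzero. -/
theorem continuous_ofAlgHom : Continuous (ofAlgHom hV) := by
  refine continuous_generateFrom_iff.2 ?_
  rintro _ ⟨W, s, O, hO, rfl⟩
  refine isOpen_iff_forall_mem_open.2 ?_
  rintro φ₀ ⟨h₀, hs₀⟩
  obtain ⟨g, hgW, hg⟩ := hV.exists_basicOpen_le ⟨_, h₀⟩ (ofAlgHom_mem hV φ₀)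
  have hloc := hV.isLocalization_basicOpen g
  obtain ⟨⟨a, ⟨_, n, rfl⟩⟩, ha⟩ := IsLocalization.surj (Submonoid.powers g)
    (X.left.presheaf.map (homOfLE hgW).op s)
  have key : ∀ φ : Γ(X.left, V) →ₐ[ℂ] ℂ, φ g ≠ 0 → ∀ h : (ofAlgHom hV φ).pt ∈ W,
      (ofAlgHom hV φ).eval h s = φ a / φ g ^ n := by
    intro φ hφ h
    have hD := (ofAlgHom_mem_basicOpen_iff hV φ g).2 hφ
    have e1 := congrArg ((ofAlgHom hV φ).evalHom hD) ha
    rw [map_mul] at e1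
    change (ofAlgHom hV φ).eval hD (X.left.presheaf.map (homOfLE hgW).op s) *
      (ofAlgHom hV φ).eval hD (X.left.presheaf.map (homOfLE (X.left.basicOpen_le g)).op (g ^ n)) =
      (ofAlgHom hV φ).eval hD (X.left.presheaf.map (homOfLE (X.left.basicOpen_le g)).op a) at e1
    rw [eval_restrict, eval_restrict, eval_restrict, ofAlgHom_eval, ofAlgHom_eval, map_pow] at e1
    exact eq_div_of_mul_eq (pow_ne_zero n hφ) e1
  have hg0 := (ofAlgHom_mem_basicOpen_iff hV φ₀ g).1 hg
  have hopen : IsOpen {φ : Γ(X.left, V) →ₐ[ℂ] ℂ | φ g ≠ 0} :=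
    isOpen_ne.preimage (continuous_algPoint_apply g)
  have hc : ContinuousOn (fun φ : Γ(X.left, V) →ₐ[ℂ] ℂ => φ a / φ g ^ n) {φ | φ g ≠ 0} :=
    (continuous_algPoint_apply a).continuousOn.div
      ((continuous_algPoint_apply g).pow n).continuousOn fun φ hφ => pow_ne_zero n hφ
  refine ⟨_, ?_, hc.isOpen_inter_preimage hopen hO, hg0, ?_⟩
  · rintro φ ⟨hφ, hφO⟩
    have h : (ofAlgHom hV φ).pt ∈ W := hgW ((ofAlgHom_mem_basicOpen_iff hV φ g).2 hφ)
    exact ⟨h, by rw [key φ hφ h]; exact hφO⟩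
  · change φ₀ a / φ₀ g ^ n ∈ O
    rwa [← key φ₀ hg0 h₀]

/-- The inverse on the open set `pointsIn V` is evaluation, continuous by definition of the analytic
topology. -/
theorem isOpenMap_ofAlgHom : IsOpenMap (ofAlgHom hV) := by
  intro O hO
  have hc : Continuous fun x : (pointsIn V : Set (ComplexPoint X)) =>
      (x : ComplexPoint X).evalHom x.2 := by
    refine continuous_algPoint_iff.2 fun f => ?_
    refine continuous_def.2 fun O' hO' => ?_
    convert (isOpen_setOf_eval f hO').preimage continuous_subtype_val using 1
    ext x
    exact ⟨fun h => ⟨x.2, h⟩, fun ⟨_, h⟩ => h⟩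
  convert (isOpen_pointsIn V).isOpenMap_subtype_val _ (hO.preimage hc) using 1
  ext x
  constructor
  · rintro ⟨φ, hφ, rfl⟩
    refine ⟨⟨_, ofAlgHom_mem hV φ⟩, ?_, rfl⟩
    change evalHom _ _ ∈ O
    rwa [evalHom_ofAlgHom]
  · rintro ⟨y, hy, rfl⟩
    exact ⟨_, hy, ofAlgHom_evalHom hV _ y.2⟩

end Affine

end ComplexPoint

/-! ### Functoriality of evaluation -/

namespace ComplexPoint

variable {X Y Z : Over SpecC}

theorem pullback_comp (f : X ⟶ Y) (g : Y ⟶ Z) {U : Z.left.Opens} {V : Y.left.Opens}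
    {W : X.left.Opens} (e : V ≤ g.left ⁻¹ᵁ U) (e' : W ≤ f.left ⁻¹ᵁ V)
    (e'' : W ≤ (f ≫ g).left ⁻¹ᵁ U) :
    pullback (f ≫ g) U W e'' = (pullback f V W e').comp (pullback g U V e) := by
  ext s
  rw [AlgHom.comp_apply, pullback_apply, pullback_apply, pullback_apply]
  simp only [Over.comp_left]
  rw [← Scheme.Hom.appLE_comp_appLE _ _ U V W e e']
  rfl

theorem pullback_id (W : X.left.Opens) (e : W ≤ (𝟙 X : X ⟶ X).left ⁻¹ᵁ W) :
    pullback (𝟙 X) W W e = AlgHom.id ℂ _ := by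
  ext s
  rw [pullback_apply]
  simp only [Over.id_left, Scheme.Hom.appLE, Scheme.Hom.id_app]
  exact congrArg (fun h => h.hom s) (X.left.presheaf.map_id _)

theorem evalHom_map (f : X ⟶ Y) (x : ComplexPoint X) {V : Y.left.Opens} {W : X.left.Opens}
    (e : W ≤ f.left ⁻¹ᵁ V) (h : x.pt ∈ W) (h' : (x.map f).pt ∈ V) :
    (x.map f).evalHom h' = (x.evalHom h).comp (pullback f V W e) :=
  AlgHom.ext fun s => eval_pullback f x e h h' s

theorem ext_evalHom {V : X.left.Opens} (hV : IsAffineOpen V) {x y : ComplexPoint X}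
    (hx : x.pt ∈ V) (hy : y.pt ∈ V) (h : x.evalHom hx = y.evalHom hy) : x = y := by
  rw [← ofAlgHom_evalHom hV x hx, h, ofAlgHom_evalHom]

theorem map_ofAlgHom (f : X ⟶ Y) {V : Y.left.Opens} {W : X.left.Opens} (hV : IsAffineOpen V)
    (hW : IsAffineOpen W) (e : W ≤ f.left ⁻¹ᵁ V) (φ : Γ(X.left, W) →ₐ[ℂ] ℂ) :
    (ofAlgHom hW φ).map f = ofAlgHom hV (φ.comp (pullback f V W e)) := by
  refine ext_evalHom hV (e (ofAlgHom_mem hW φ)) (ofAlgHom_mem hV _) ?_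
  rw [evalHom_ofAlgHom]
  exact (evalHom_map f _ e (ofAlgHom_mem hW φ) _).trans
    (congrArg (AlgHom.comp · _) (evalHom_ofAlgHom hW φ))

end ComplexPoint

open ComplexPoint

/-! ### The complement of a dense open subset of a smooth scheme -/

theorem isStandardSmooth_sections {X : Over SpecC} [Smooth (structureMorphism X)]
    (x : ComplexPoint X) : ∃ V : X.left.Opens, IsAffineOpen V ∧ x.pt ∈ V ∧
      Algebra.IsStandardSmooth ℂ Γ(X.left, V) := by
  obtain ⟨U₀, hU₀, V, hV, hx, e, h⟩ := Smooth.exists_isStandardSmooth (structureMorphism X) x.pt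
  -- `Spec ℂ` has a single point, so the open subset of the base is everything.
  obtain rfl : U₀ = ⊤ := by
    refine top_le_iff.1 fun s _ => ?_
    rw [Subsingleton.elim (α := PrimeSpectrum ℂ) s (structureMorphism X x.pt)]
    exact e hx
  refine ⟨V, hV, hx, ?_⟩
  exact RingHom.isStandardSmooth_respectsIso.right _
    (Scheme.ΓSpecIso (CommRingCat.of ℂ)).symm.commRingCatIsoToRingEquiv h

/-- On an affine `V`, the set `U` is where some `f` with basic open set inside `U` is nonzero.
Density says that the basic open set of any `u` nonzero at `x` meets one of these, so `u * f ≠ 0`.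
-/
theorem hasLocallyConnectedTrace_pointsIn {X : Over SpecC} (hX : Smooth (structureMorphism X))
    {U : X.left.Opens} (hU : Dense (U : Set X.left)) :
    HasLocallyConnectedTrace (pointsIn U) := by
  intro x O hO hxO
  obtain ⟨V, hV, hxV, hVs⟩ := isStandardSmooth_sections x
  have hS : ∀ u : Γ(X.left, V), x.evalHom hxV u ≠ 0 →
      ∃ f ∈ {f : Γ(X.left, V) | X.left.basicOpen f ≤ U}, u * f ≠ 0 := by
    intro u hu
    obtain ⟨z, hzu, hzU⟩ := hU.inter_open_nonempty _ (X.left.basicOpen u).isOpen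
      ⟨x.pt, (mem_basicOpen_iff x hxV u).2 hu⟩
    obtain ⟨f, hf, hzf⟩ := hV.exists_basicOpen_le ⟨z, hzU⟩ (X.left.basicOpen_le u hzu)
    refine ⟨f, hf, fun h0 => ?_⟩
    have hz : z ∈ X.left.basicOpen (u * f) := by
      rw [Scheme.basicOpen_mul]
      exact ⟨hzu, hzf⟩
    rw [h0, Scheme.basicOpen_zero] at hz
    exact hz
  obtain ⟨N, hN, hxN, hNO, hNc⟩ := exists_isPathConnected_inter (x.evalHom hxV)
    (hO.preimage (continuous_ofAlgHom hV))
    (by rw [Set.mem_preimage, ofAlgHom_evalHom]; exact hxO) _ hS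
  refine ⟨ofAlgHom hV '' N, isOpenMap_ofAlgHom hV _ hN, ⟨_, hxN, ofAlgHom_evalHom hV x hxV⟩,
    Set.image_subset_iff.2 hNO, ?_⟩
  convert hNc.image (continuous_ofAlgHom hV) using 1
  rw [Set.image_inter_preimage (ofAlgHom hV) N (pointsIn U) |>.symm]
  congr 2
  ext φ
  constructor
  · intro hφ
    obtain ⟨f, hf, hφf⟩ := hV.exists_basicOpen_le ⟨_, hφ⟩ (ofAlgHom_mem hV φ)
    exact ⟨f, hf, (ofAlgHom_mem_basicOpen_iff hV φ f).1 hφf⟩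
  · rintro ⟨f, hf, hφf⟩
    exact hf ((ofAlgHom_mem_basicOpen_iff hV φ f).2 hφf)

/-! ### The quotient map on complex points -/

section Quotient

variable {G : Type*} [Group G] {X Y : Over SpecC} {ρ : G →* Aut X} {π : X ⟶ Y}

/-- The action on the sections over the preimage of an open subset of the quotient. -/
def sectionsAction (hπ : IsQuotient ρ π) (V : Y.left.Opens) (g : G) :
    Γ(X.left, π.left ⁻¹ᵁ V) →ₐ[ℂ] Γ(X.left, π.left ⁻¹ᵁ V) :=
  pullback (ρ g).hom (π.left ⁻¹ᵁ V) (π.left ⁻¹ᵁ V) (le_preimage (hπ.invariant g) V)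

theorem pullback_congr {f f' : X ⟶ Y} (h : f = f') {V : Y.left.Opens} {W : X.left.Opens}
    (e : W ≤ f.left ⁻¹ᵁ V) (e' : W ≤ f'.left ⁻¹ᵁ V) : pullback f V W e = pullback f' V W e' := by
  subst h
  rfl

theorem IsQuotient.isInvariantRing (hπ : IsQuotient ρ π) (V : Y.left.Opens) :
    IsInvariantRing (sectionsAction hπ V) (pullback π V (π.left ⁻¹ᵁ V) le_rfl) where
  one := by
    rw [← pullback_id _ le_rfl]
    exact pullback_congr (by rw [map_one]; rfl) _ _
  mul g h := by
    -- In `Aut X` the product applies `h` first, so pullback of functions is a right action.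
    have hgh : (ρ (g * h)).hom = (ρ h).hom ≫ (ρ g).hom := by rw [map_mul]; rfl
    have e : π.left ⁻¹ᵁ V ≤ ((ρ h).hom ≫ (ρ g).hom).left ⁻¹ᵁ (π.left ⁻¹ᵁ V) := by
      rw [← hgh]
      exact le_preimage (hπ.invariant (g * h)) V
    exact (pullback_congr hgh _ e).trans (pullback_comp (ρ h).hom (ρ g).hom _ _ e)
  injective := by
    have h := hπ.injective V
    rw [← Scheme.Hom.appLE_eq_app] at h
    exact h
  mem_range_iff a := by
    have h := hπ.range V a
    rw [← Scheme.Hom.appLE_eq_app] at h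
    exact h

theorem IsQuotient.isAffineOpen_preimage (hπ : IsQuotient ρ π) {V : Y.left.Opens}
    (hV : IsAffineOpen V) : IsAffineOpen (π.left ⁻¹ᵁ V) :=
  have := hπ.affine
  hV.preimage π.left

theorem IsQuotient.map_eq_map (hπ : IsQuotient ρ π) (g : G) (x : ComplexPoint X) :
    (x.map (ρ g).hom).map π = x.map π := by
  have h : (x.map (ρ g).hom).map π = x.map ((ρ g).hom ≫ π) :=
    Category.assoc (obj := Over SpecC) _ _ _
  rw [h, hπ.invariant]

theorem IsQuotient.exists_map_eq [Finite G] (hπ : IsQuotient ρ π) {x y : ComplexPoint X}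
    (h : x.map π = y.map π) : ∃ g : G, x.map (ρ g).hom = y := by
  obtain ⟨V, hV, hxV, -⟩ := exists_isAffineOpen_mem_and_subset
    (show (x.map π).pt ∈ (⊤ : Y.left.Opens) from trivial)
  have hyV : (y.map π).pt ∈ V := h ▸ hxV
  have hxW : x.pt ∈ π.left ⁻¹ᵁ V := hxV
  have hyW : y.pt ∈ π.left ⁻¹ᵁ V := hyV
  have hxy : (x.evalHom hxW).comp (pullback π V _ le_rfl) =
      (y.evalHom hyW).comp (pullback π V _ le_rfl) := by
    rw [← evalHom_map π x le_rfl hxW hxV, ← evalHom_map π y le_rfl hyW hyV]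
    congr 1
  obtain ⟨g, hg⟩ := (hπ.isInvariantRing V).exists_comp_eq hxy
  have hgW : (x.map (ρ g).hom).pt ∈ π.left ⁻¹ᵁ V := le_preimage (hπ.invariant g) V hxW
  refine ⟨g, ext_evalHom (hπ.isAffineOpen_preimage hV) hgW hyW ?_⟩
  rw [← hg]
  exact evalHom_map _ _ _ hxW hgW

theorem IsQuotient.isOpenMap_map [Finite G] (hπ : IsQuotient ρ π) : IsOpenMap (map π) := by
  intro O hO
  refine isOpen_iff_forall_mem_open.2 ?_
  rintro _ ⟨x, hx, rfl⟩
  obtain ⟨V, hV, hxV, -⟩ := exists_isAffineOpen_mem_and_subset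
    (show (x.map π).pt ∈ (⊤ : Y.left.Opens) from trivial)
  have hxW : x.pt ∈ π.left ⁻¹ᵁ V := hxV
  have hW := hπ.isAffineOpen_preimage hV
  have ho := isOpenMap_ofAlgHom hV _ ((hπ.isInvariantRing V).isOpenMap _
    (hO.preimage (continuous_ofAlgHom hW)))
  refine ⟨_, ?_, ho, ?_⟩
  · rintro _ ⟨_, ⟨φ, hφ, rfl⟩, rfl⟩
    exact ⟨_, hφ, map_ofAlgHom π hV hW le_rfl φ⟩
  · refine ⟨_, ⟨x.evalHom hxW, ?_, rfl⟩, ?_⟩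
    · rw [Set.mem_preimage, ofAlgHom_evalHom]
      exact hx
    · rw [← map_ofAlgHom π hV hW le_rfl, ofAlgHom_evalHom]

/-- Both points lie in the affine preimage of one affine open of `Y`, so a regular function
separates them. -/
theorem IsQuotient.exists_disjoint (hπ : IsQuotient ρ π) {x y : ComplexPoint X}
    (h : x.map π = y.map π) (hne : y ≠ x) : ∃ O O' : Set (ComplexPoint X),
      IsOpen O ∧ IsOpen O' ∧ x ∈ O ∧ y ∈ O' ∧ Disjoint O O' := by
  obtain ⟨V, hV, hxV, -⟩ := exists_isAffineOpen_mem_and_subset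
    (show (x.map π).pt ∈ (⊤ : Y.left.Opens) from trivial)
  have hxW : x.pt ∈ π.left ⁻¹ᵁ V := hxV
  have hyW : y.pt ∈ π.left ⁻¹ᵁ V := (h ▸ hxV : (y.map π).pt ∈ V)
  obtain ⟨f, hf⟩ : ∃ f, x.eval hxW f ≠ y.eval hyW f := by
    by_contra! hc
    exact hne (ext_evalHom (hπ.isAffineOpen_preimage hV) hxW hyW (AlgHom.ext hc)).symm
  obtain ⟨A, B, hA, hB, hxA, hyB, hAB⟩ := t2_separation hf
  refine ⟨_, _, isOpen_setOf_eval f hA, isOpen_setOf_eval f hB, ⟨hxW, hxA⟩, ⟨hyW, hyB⟩, ?_⟩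
  rw [Set.disjoint_left]
  rintro z ⟨_, hz⟩ ⟨_, hz'⟩
  exact Set.disjoint_left.1 hAB hz hz'

theorem IsQuotient.isSeparatedQuotient [Finite G] (hπ : IsQuotient ρ π) :
    letI := pointAction ρ
    IsSeparatedQuotient G (map π) :=
  letI := pointAction ρ
  { continuous_smul := fun g => continuous_map (ρ g).hom
    continuous := continuous_map π
    isOpenMap := hπ.isOpenMap_map
    eq_iff := fun a b => ⟨hπ.exists_map_eq, by
      rintro ⟨g, rfl⟩
      exact (hπ.map_eq_map g a).symm⟩
    separated := fun g a hne => hπ.exists_disjoint (hπ.map_eq_map g a).symm hne }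

theorem ActsFreelyOn.isFreeOpen {U : X.left.Opens} (hU : ActsFreelyOn ρ U) :
    letI := pointAction ρ
    IsFreeOpen G (pointsIn U) :=
  letI := pointAction ρ
  { isOpen := isOpen_pointsIn U
    smul_mem := fun g a ha => by
      have h : a.pt ∈ (ρ g).hom.left ⁻¹ᵁ U := by rw [hU.stable g]; exact ha
      exact h
    free := fun g a ha hg => by
      have h : g ∈ pointStabilizer ρ a := hg
      rwa [hU.free a ha, Subgroup.mem_bot] at h }

end Quotient

end

end GaloisMonodromy

/-! ### The theorem for schemes -/

theorem mainTheorem10 {G : Type*} [Group G] [Finite G] {X Y : Over GaloisMonodromy.SpecC}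
    (hXqp : GaloisMonodromy.IsQuasiProjective X) (hXsm : Smooth X.hom)
    (ρ : G →* Aut X)
    (U : X.left.Opens) (hUdense : Dense (U : Set X.left))
    (hUfree : GaloisMonodromy.ActsFreelyOn ρ U)
    (π : X ⟶ Y) (hπ : GaloisMonodromy.IsQuotient ρ π) (hYsm : Smooth Y.hom)
    (x : GaloisMonodromy.ComplexPoint X) (hx : x ∉ GaloisMonodromy.ComplexPoint.pointsIn U) :
    letI := GaloisMonodromy.pointAction ρ
    (∀ W : Set (GaloisMonodromy.ComplexPoint Y),
      GaloisMonodromy.IsGoodNeighborhood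
        (GaloisMonodromy.ComplexPoint.map π '' GaloisMonodromy.ComplexPoint.pointsIn U)ᶜ
        (x.map π) W →
      GaloisMonodromy.LocalMonodromyEq (GaloisMonodromy.ComplexPoint.map π)
        (GaloisMonodromy.ComplexPoint.pointsIn U) W (GaloisMonodromy.pointStabilizer ρ x)) ∧
    (∃ N : Set (GaloisMonodromy.ComplexPoint Y), IsOpen N ∧ x.map π ∈ N ∧
      ∀ B : Set (GaloisMonodromy.ComplexPoint Y),
        IsOpen B → IsConnected B → x.map π ∈ B → B ⊆ N →
        GaloisMonodromy.LocalMonodromyEq (GaloisMonodromy.ComplexPoint.map π)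
          (GaloisMonodromy.ComplexPoint.pointsIn U) B (GaloisMonodromy.pointStabilizer ρ x)) :=
  letI := GaloisMonodromy.pointAction ρ
  GaloisMonodromy.localMonodromyEq_stabilizer hπ.isSeparatedQuotient hUfree.isFreeOpen
    (GaloisMonodromy.hasLocallyConnectedTrace_pointsIn hXsm hUdense) x
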